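/- Let $N,M\ge 1$ be integers and let $A\in\mathbb{C}^{(N+M)\times(N+M)}$ be invertible. Let $\phi=\phi(x,t)$ and $\psi=\psi(x,t)$ be smooth functions of $(x,t)\in\mathbb{R}^2$ with values in $\mathbb{C}^{N+M}$ (column vectors) satisfying $$\phi_x=\tfrac{i}{2}A^2\phi,\quad \phi_t=-\tfrac14\partial_x^{-1}\phi,\qquad \psi_x=-\tfrac{i}{2}A^2\psi,\quad \psi_t=-\tfrac14\partial_x^{-1}\psi, \qquad (1)$$ where $\partial_x^{-1}$ is the inverse of $\partial_x$ (i.e. $-4\phi_t$ and $-4\psi_t$ are $x$-antiderivatives of $\phi$ and $\psi$). Write $|a,\dots,b;c,\dots,d|$ for the $(N+M)\times(N+M)$ determinant with columns $\partial_x^a\phi,\dots,\partial_x^b\phi,\partial_x^c\psi,\dots,\partial_x^d\psi$, where a range of columns whose last index is one less than its first is empty, and put $$f=|1,\dots,N;0,\dots,M-1|,\quad g=|0,\dots,N;1,\dots,M-1|,\quad h=-\tfrac{i}{2}|2,\dots,N;0,\dots,M|,\quad s=|1,\dots,N;1,\dots,M|.$$ With Hirota's operator $D_x^mD_t^n\,a\cdot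 b=(\partial_x-\partial_{x'})^m(\partial_t-\partial_{t'})^n\,a(x,t)\,b(x',t')\big|_{x'=x,\,t'=t}$, the functions $f,g,h,s$ are smooth and satisfy on $\mathbb{R}^2$ the bilinear system $$D_xD_t\,g\cdot f+gf=0,\quad D_xD_t\,h\cdot s+hs=0,\quad D_xD_t\,f\cdot s+iD_x\,g\cdot h=0,\quad D_t\,f\cdot s+igh=0.$$ Furthermore, on the open set where $f\ne0$ and $s\ne0$, the functions $u=g/f$ and $v=h/s$ are smooth and solve the pKN$(-1)$ system $$u_{xt}+u-2iuvu_x=0,\qquad v_{xt}+v+2iuvv_x=0.$$ Moreover, smooth $\phi,\psi$ satisfy (1) if and only if there are constant vectors $B,C\in\mathbb{C}^{N+M}$ such that for all $(x,t)$ $$\phi=\exp\Bigl(\tfrac{i}{2}A^2x+\tfrac{i}{2}A^{-2}t\Bigr)C,\qquad \psi=\exp\Bigl(-\tfrac{i}{2}A^2x-\tfrac{i}{2}A^{-2}t\Bigr)B.$$ -/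

import Mathlib

open Complex Matrix
open scoped ContDiff

noncomputable section

/-- Partial derivative in the first (space) variable `x` of a function of `(x, t)`. -/
def pdx {E : Type*} [NormedAddCommGroup E] [NormedSpace ℝ E] (F : ℝ → ℝ → E) : ℝ → ℝ → E :=
  fun x t => deriv (fun y => F y t) x

/-- Partial derivative in the second (time) variable `t` of a function of `(x, t)`. -/
def pdt {E : Type*} [NormedAddCommGroup E] [NormedSpace ℝ E] (F : ℝ → ℝ → E) : ℝ → ℝ → E :=
  fun x t => deriv (fun r => F x r) t

/-- Joint smoothness of a function of `(x, t)`. -/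
def IsSmooth {E : Type*} [NormedAddCommGroup E] [NormedSpace ℝ E] (F : ℝ → ℝ → E) : Prop :=
  ContDiff ℝ ∞ (fun p : ℝ × ℝ => F p.1 p.2)

/-- The operator `∂_x - ∂_{x'}` on functions of `(x, t, x', t')`. -/
def hirotaX (F : ℝ → ℝ → ℝ → ℝ → ℂ) : ℝ → ℝ → ℝ → ℝ → ℂ :=
  fun x t x' t' => deriv (fun y => F y t x' t') x - deriv (fun y => F x t y t') x'

/-- The operator `∂_t - ∂_{t'}` on functions of `(x, t, x', t')`. -/
def hirotaT (F : ℝ → ℝ → ℝ → ℝ → ℂ) : ℝ → ℝ → ℝ → ℝ → ℂ :=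
  fun x t x' t' => deriv (fun r => F x r x' t') t - deriv (fun r => F x t x' r) t'

/-- Hirota's bilinear operator
`D_x^m D_t^n a · b = (∂_x - ∂_{x'})^m (∂_t - ∂_{t'})^n a(x, t) b(x', t') |_{x' = x, t' = t}`. -/
def hirota (m n : ℕ) (a b : ℝ → ℝ → ℂ) : ℝ → ℝ → ℂ :=
  fun x t => (hirotaX^[m] (hirotaT^[n] (fun x t x' t' => a x t * b x' t'))) x t x t

/-- `f, g, h, s` are smooth solutions of the bilinear system. -/
def IsBilinearSolution (f g h s : ℝ → ℝ → ℂ) : Prop :=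
  (IsSmooth f ∧ IsSmooth g ∧ IsSmooth h ∧ IsSmooth s) ∧
  (∀ x t, hirota 1 1 g f x t + g x t * f x t = 0) ∧
  (∀ x t, hirota 1 1 h s x t + h x t * s x t = 0) ∧
  (∀ x t, hirota 1 1 f s x t + I * hirota 1 0 g h x t = 0) ∧
  (∀ x t, hirota 0 1 f s x t + I * (g x t * h x t) = 0)

/-- `(u, v)` is a smooth solution on the open set `Ω` of the pKN(-1) system
`u_xt + u - 2 i u v u_x = 0`, `v_xt + v + 2 i u v v_x = 0`. -/
def IsPKNSolutionOn (u v : ℝ → ℝ → ℂ) (Ω : Set (ℝ × ℝ)) : Prop :=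
  IsOpen Ω ∧
  ContDiffOn ℝ ∞ (fun p : ℝ × ℝ => u p.1 p.2) Ω ∧
  ContDiffOn ℝ ∞ (fun p : ℝ × ℝ => v p.1 p.2) Ω ∧
  ∀ x t : ℝ, (x, t) ∈ Ω →
    pdt (pdx u) x t + u x t - 2 * I * u x t * v x t * pdx u x t = 0 ∧
    pdt (pdx v) x t + v x t + 2 * I * u x t * v x t * pdx v x t = 0

/-- The double Wronskian `|a, a+1, …, a+n-1; b, b+1, …, b+(K-n)-1|` of order `K`: its first `n`
columns are `∂_x^a φ, …, ∂_x^(a+n-1) φ` and its remaining `K - n` columns are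
`∂_x^b ψ, …, ∂_x^(b+K-n-1) ψ`. -/
def doubleWronskian {K : ℕ} (φ ψ : ℝ → ℝ → Fin K → ℂ) (a n b : ℕ) : ℝ → ℝ → ℂ :=
  fun x t => Matrix.det (Matrix.of fun i j : Fin K =>
    if (j : ℕ) < n then (pdx^[a + j] φ) x t i else (pdx^[b + (j - n)] ψ) x t i)

/-- `f = |1, …, N; 0, …, M-1|`. -/
def wronF {N M : ℕ} (φ ψ : ℝ → ℝ → Fin (N + M) → ℂ) : ℝ → ℝ → ℂ :=
  doubleWronskian φ ψ 1 N 0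

/-- `g = |0, …, N; 1, …, M-1|` (meaningful for `1 ≤ M`). -/
def wronG {N M : ℕ} (φ ψ : ℝ → ℝ → Fin (N + M) → ℂ) : ℝ → ℝ → ℂ :=
  doubleWronskian φ ψ 0 (N + 1) 1

/-- `h = -(i/2) |2, …, N; 0, …, M|` (meaningful for `1 ≤ N`). -/
def wronH {N M : ℕ} (φ ψ : ℝ → ℝ → Fin (N + M) → ℂ) : ℝ → ℝ → ℂ :=
  fun x t => -(I / 2) * doubleWronskian φ ψ 2 (N - 1) 0 x t

/-- `s = |1, …, N; 1, …, M|`. -/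
def wronS {N M : ℕ} (φ ψ : ℝ → ℝ → Fin (N + M) → ℂ) : ℝ → ℝ → ℂ :=
  doubleWronskian φ ψ 1 N 1

/-- `Φ` is an antiderivative of `φ` in the variable `x`, i.e. a value of `∂_x⁻¹ φ`. -/
def IsXAntideriv {K : ℕ} (Φ φ : ℝ → ℝ → Fin K → ℂ) : Prop :=
  ∀ x t, HasDerivAt (fun y => Φ y t) (φ x t) x

/-- The linear conditions `φ_x = (i/2) A² φ`, `φ_t = -(1/4) ∂_x⁻¹ φ`,
`ψ_x = -(i/2) A² ψ`, `ψ_t = -(1/4) ∂_x⁻¹ ψ` on smooth vectors `φ`, `ψ`. -/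
def WronskianCondition {K : ℕ} (A : Matrix (Fin K) (Fin K) ℂ)
    (φ ψ : ℝ → ℝ → Fin K → ℂ) : Prop :=
  IsSmooth φ ∧ IsSmooth ψ ∧
  (∀ x t, pdx φ x t = (I / 2) • ((A ^ 2) *ᵥ φ x t)) ∧
  (∃ Φ, IsXAntideriv Φ φ ∧ ∀ x t, pdt φ x t = (-(1 / 4) : ℂ) • Φ x t) ∧
  (∀ x t, pdx ψ x t = (-(I / 2)) • ((A ^ 2) *ᵥ ψ x t)) ∧
  (∃ Ψ, IsXAntideriv Ψ ψ ∧ ∀ x t, pdt ψ x t = (-(1 / 4) : ℂ) • Ψ x t)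

end

/-! Put `L = (i/2)A²` and `R = (i/2)A⁻²`, so that `RL = -1/4`. Condition (1) then says that `φ`
flows by `L` in `x` and `R` in `t`, and `ψ` by `-L` and `-R` (`columnFlow_iff`); as `L` and `R`
commute, the solutions are exponentials (`columnFlow_one_iff`). Up to scalars, `L` raises and `R`
lowers the order of a column.

Differentiating a double Wronskian replaces one column at a time, with sign + on the `φ` block and -
on the `ψ` block. The sum without these signs is a trace times the determinant
(`sum_colDet_update_mulVec`), and within one block all replacements but one produce a repeated
column. Hence each first derivative is one new determinant plus a trace multiple of the old one, and
either block may be used to compute it (`sum_forward_sub_backward` and its mirror). The trace terms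
cancel in the bilinear equations, which thereby become quadratic identities between determinants.

Those identities come from the exchange (Plücker) relation `colDet_exchange`, a form of Cramer's
rule. `D_t f·s` is one three-term relation; the same relation with another last column, combined
with the `x`-derivative of the first, gives `D_x D_t f·s`. The equation for `g·f` also has an
undifferentiated term: there the determinants are related by applying `L` to every column, which
costs `det L ≠ 0`. The equation for `h·s` is its image under the exchange of `φ` and `ψ`.

For pKN(-1), the last two bilinear equations give `(log f)_xt = -i v u_x` and `(log s)_xt = i u
v_x`, while the first two give `u_xt + u = -2u (log f)_xt` and `v_xt + v = -2v (log s)_xt`. -/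

/-- The determinant whose columns are the first `K` vectors of the sequence `c`. -/
noncomputable def colDet {K : ℕ} (c : ℕ → Fin K → ℂ) : ℂ :=
  Matrix.det (Matrix.of fun i j : Fin K => c j i)

/-! ### Determinants as functions of their columns -/

section ColDet

variable {K : ℕ}

theorem colDet_congr {c d : ℕ → Fin K → ℂ} (h : ∀ j < K, c j = d j) : colDet c = colDet d := by
  unfold colDet
  congr 1
  ext i j
  simp [h j j.2]

theorem colDet_eq_zero {c : ℕ → Fin K → ℂ} {i j : ℕ} (hi : i < K) (hj : j < K) (hij : i ≠ j)
    (h : c i = c j) : colDet c = 0 := by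
  refine Matrix.det_zero_of_column_eq (i := ⟨i, hi⟩) (j := ⟨j, hj⟩) (by simpa using hij) ?_
  intro k
  simp [h]

theorem of_update (c : ℕ → Fin K → ℂ) {k : ℕ} (hk : k < K) (v : Fin K → ℂ) :
    (Matrix.of fun i j : Fin K => Function.update c k v j i) =
      (Matrix.of fun i j : Fin K => c j i).updateCol ⟨k, hk⟩ v := by
  ext i j
  by_cases h : (j : ℕ) = k
  · have : j = ⟨k, hk⟩ := Fin.ext h
    subst this
    simp
  · have : j ≠ ⟨k, hk⟩ := fun h' => h (by simp [h'])
    simp [Function.update_of_ne h, Matrix.updateCol_ne this]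

theorem colDet_update (c : ℕ → Fin K → ℂ) {k : ℕ} (hk : k < K) (v : Fin K → ℂ) :
    colDet (Function.update c k v) =
      Matrix.cramer (Matrix.of fun i j : Fin K => c j i) v ⟨k, hk⟩ := by
  rw [Matrix.cramer_apply, colDet, of_update c hk]

theorem colDet_update_smul (c : ℕ → Fin K → ℂ) {k : ℕ} (hk : k < K) (r : ℂ) (v : Fin K → ℂ) :
    colDet (Function.update c k (r • v)) = r * colDet (Function.update c k v) := by
  simp [colDet_update _ hk]

/-- The exchange relation between two determinants. -/
theorem colDet_exchange (a c : ℕ → Fin K → ℂ) {k : ℕ} (hk : k < K) :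
    colDet a * colDet c =
      ∑ i ∈ Finset.range K,
        colDet (Function.update a i (c k)) * colDet (Function.update c k (a i)) := by
  -- Cramer's rule writes `det a • c k` as a combination of the columns of `a`; substituting it for
  -- column `k` of `c` gives the relation by linearity.
  have h := Matrix.mulVec_cramer (Matrix.of fun i j : Fin K => a j i) (c k)
  have h2 : colDet a • c k =
      ∑ i : Fin K, colDet (Function.update a i (c k)) • a i := by
    rw [colDet, ← h]
    ext l
    simp only [Matrix.mulVec, dotProduct, Finset.sum_apply, Pi.smul_apply, smul_eq_mul,
      Matrix.of_apply]
    exact Finset.sum_congr rfl fun i _ => by rw [colDet_update a i.2, mul_comm]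
  have h3 : colDet a * colDet c = colDet (Function.update c k (colDet a • c k)) := by
    rw [colDet_update_smul _ hk, Function.update_eq_self]
  rw [h3, h2, colDet_update _ hk, map_sum, Finset.sum_apply,
    Finset.sum_range fun i => colDet (Function.update a i (c k)) * colDet (Function.update c k (a i))]
  refine Finset.sum_congr rfl fun i _ => ?_
  rw [map_smul, Pi.smul_apply, smul_eq_mul, ← colDet_update c hk]

/-- The exchange relation when at most one column of `a` is missing from the other columns
of `c`. -/
theorem colDet_exchange_one (a c : ℕ → Fin K → ℂ) {k p : ℕ} (hk : k < K) (hp : p < K)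
    (h : ∀ i < K, i ≠ p → ∃ j < K, j ≠ k ∧ c j = a i) :
    colDet a * colDet c =
      colDet (Function.update a p (c k)) * colDet (Function.update c k (a p)) := by
  rw [colDet_exchange a c hk]
  refine Finset.sum_eq_single p (fun i hi hip => ?_) (by simp [hp])
  obtain ⟨j, hj, hjk, hji⟩ := h i (Finset.mem_range.1 hi) hip
  rw [colDet_eq_zero hj hk hjk (c := Function.update c k (a i)) (by simp [hjk, hji]), mul_zero]

/-- The exchange relation when at most two columns of `a` are missing from the other columns
of `c`. -/
theorem colDet_exchange_two (a c : ℕ → Fin K → ℂ) {k p q : ℕ} (hk : k < K) (hp : p < K)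
    (hq : q < K) (hpq : p ≠ q)
    (h : ∀ i < K, i ≠ p → i ≠ q → ∃ j < K, j ≠ k ∧ c j = a i) :
    colDet a * colDet c =
      colDet (Function.update a p (c k)) * colDet (Function.update c k (a p)) +
      colDet (Function.update a q (c k)) * colDet (Function.update c k (a q)) := by
  rw [colDet_exchange a c hk]
  rw [← Finset.sum_pair hpq (f := fun i =>
    colDet (Function.update a i (c k)) * colDet (Function.update c k (a i)))]
  symm
  refine Finset.sum_subset ?_ ?_
  · intro i hi
    rcases Finset.mem_insert.1 hi with rfl | hi
    · simpa using hp
    · rw [Finset.mem_singleton.1 hi]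
      simpa using hq
  intro i hi hi2
  simp only [Finset.mem_insert, Finset.mem_singleton, not_or] at hi2
  obtain ⟨j, hj, hjk, hji⟩ := h i (Finset.mem_range.1 hi) hi2.1 hi2.2
  rw [colDet_eq_zero hj hk hjk (c := Function.update c k (a i)) (by simp [hjk, hji]), mul_zero]

/-- By Cramer's rule each summand is a diagonal entry of `adj(C) A C`, and the trace of that matrix
is `tr(A C adj C) = tr A · det C`. -/
theorem sum_colDet_update_mulVec (A : Matrix (Fin K) (Fin K) ℂ) (c : ℕ → Fin K → ℂ) :
    ∑ j ∈ Finset.range K, colDet (Function.update c j (A *ᵥ c j)) = A.trace * colDet c := by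
  set C : Matrix (Fin K) (Fin K) ℂ := Matrix.of fun i j : Fin K => c j i with hC
  have : ∀ j : Fin K, colDet (Function.update c j (A *ᵥ c j)) = (C.adjugate * (A * C)) j j := by
    intro j
    rw [colDet_update _ j.2, Matrix.cramer_eq_adjugate_mulVec, ← hC]
    rfl
  rw [Finset.sum_range fun j => colDet (Function.update c j (A *ᵥ c j)),
    Finset.sum_congr rfl fun j _ => this j]
  change (C.adjugate * (A * C)).trace = _
  rw [Matrix.trace_mul_comm, Matrix.mul_assoc, Matrix.mul_adjugate, Matrix.mul_smul, Matrix.mul_one,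
    Matrix.trace_smul, smul_eq_mul, mul_comm]
  rfl

theorem colDet_mulVec (A : Matrix (Fin K) (Fin K) ℂ) (c : ℕ → Fin K → ℂ) :
    colDet (fun j => A *ᵥ c j) = A.det * colDet c := by
  rw [colDet, colDet, ← Matrix.det_mul]
  rfl

theorem colDet_smul (r : ℕ → ℂ) (c : ℕ → Fin K → ℂ) :
    colDet (fun j => r j • c j) = (∏ j ∈ Finset.range K, r j) * colDet c := by
  rw [colDet, colDet, Finset.prod_range, ← Matrix.det_mul_row]
  rfl

theorem colDet_swap (c d : ℕ → Fin K → ℂ) {i j : ℕ} (hi : i < K) (hj : j < K) (hij : i ≠ j)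
    (h1 : d i = c j) (h2 : d j = c i) (h : ∀ k < K, k ≠ i → k ≠ j → d k = c k) :
    colDet d = -colDet c := by
  have hne : (⟨i, hi⟩ : Fin K) ≠ ⟨j, hj⟩ := by simpa using hij
  have := Matrix.det_permute' (Equiv.swap (⟨i, hi⟩ : Fin K) ⟨j, hj⟩)
    (Matrix.of fun i j : Fin K => c j i)
  rw [Equiv.Perm.sign_swap hne] at this
  simp only [Units.val_neg, Units.val_one, Int.cast_neg, Int.cast_one, neg_mul, one_mul] at this
  rw [colDet, colDet, ← this]
  congr 1
  ext l k
  simp only [Matrix.of_apply, Matrix.submatrix_apply, id]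
  by_cases hki : k = ⟨i, hi⟩
  · subst hki
    simp [h1]
  by_cases hkj : k = ⟨j, hj⟩
  · subst hkj
    simp [h2]
  rw [Equiv.swap_apply_of_ne_of_ne hki hkj,
    h k k.2 (fun e => hki (Fin.ext e)) (fun e => hkj (Fin.ext e))]

/-- Moving the column in position `a` to position `a + n`. -/
theorem colDet_move (a n : ℕ) (c d : ℕ → Fin K → ℂ) (hn : a + n < K)
    (h1 : ∀ k < a, d k = c k) (h2 : ∀ k, a ≤ k → k < a + n → d k = c (k + 1))
    (h3 : d (a + n) = c a) (h4 : ∀ k, a + n < k → k < K → d k = c k) :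
    colDet d = (-1) ^ n * colDet c := by
  induction n generalizing d with
  | zero =>
    rw [pow_zero, one_mul]
    refine colDet_congr fun j hj => ?_
    rcases lt_trichotomy j a with h | rfl | h
    · exact h1 j h
    · exact h3
    · exact h4 j (by simpa using h) hj
  | succ n ih =>
    -- `e` is `d` with the columns in positions `a + n` and `a + n + 1` transposed: the moved column
    -- is one place short of its goal.
    let e : ℕ → Fin K → ℂ := fun k =>
      if k = a + n then c a else if k = a + n + 1 then c (a + n + 1) else d k
    have he : colDet e = (-1) ^ n * colDet c := by
      refine ih e (by omega) ?_ ?_ (by simp [e]) ?_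
      · intro k hk
        simp only [e, if_neg (show k ≠ a + n by omega), if_neg (show k ≠ a + n + 1 by omega)]
        exact h1 k hk
      · intro k hk hk2
        simp only [e, if_neg (show k ≠ a + n by omega), if_neg (show k ≠ a + n + 1 by omega)]
        exact h2 k hk (by omega)
      · intro k hk hk2
        by_cases hk3 : k = a + n + 1
        · subst hk3
          simp [e]
        · simp only [e, if_neg (show k ≠ a + n by omega), if_neg hk3]
          exact h4 k (by omega) hk2
    rw [pow_succ, mul_assoc, mul_comm (-1 : ℂ), ← mul_assoc, ← he, mul_neg_one]
    refine colDet_swap e d (i := a + n) (j := a + n + 1) (by omega) (by omega) (by omega) ?_ ?_ ?_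
    · simp only [e, if_neg (show a + n + 1 ≠ a + n by omega), if_true]
      exact h2 _ (by omega) (by omega)
    · simp only [e, if_true]
      exact h3
    · intro k _ hk1 hk2
      simp only [e, if_neg hk1, if_neg hk2]

/-- Exchanging two consecutive blocks of columns changes the determinant by a sign that does not
depend on the columns. -/
theorem exists_colDet_rotate (K n : ℕ) (hn : n < K) :
    ∃ ε : ℂ, ∀ c d : ℕ → Fin K → ℂ,
      (∀ k, k + n < K → d k = c (k + n)) → (∀ k < n, d (k + (K - n)) = c k) →
      colDet d = ε * colDet c := by
  let σ : Equiv.Perm (Fin K) := {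
    toFun := fun k => ⟨if k + n < K then k + n else k + n - K, by split_ifs <;> omega⟩
    invFun := fun k => ⟨if (k : ℕ) < n then k + (K - n) else k - n, by split_ifs <;> omega⟩
    left_inv := fun k => by
      ext
      simp only
      split_ifs <;> omega
    right_inv := fun k => by
      ext
      simp only
      split_ifs <;> omega }
  refine ⟨((Equiv.Perm.sign σ : ℤ) : ℂ), fun c d h1 h2 => ?_⟩
  rw [colDet, colDet, ← Matrix.det_permute']
  congr 1
  ext i k
  simp only [Matrix.of_apply, Matrix.submatrix_apply, id, σ, Equiv.coe_fn_mk]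
  split_ifs with h
  · rw [h1 k h]
  · have := h2 (k + n - K) (by omega)
    rw [← this]
    congr 2
    omega

/-- The sum over columns that a linear map sends into the span of other columns collapses. -/
theorem sum_colDet_update_eq (A : Matrix (Fin K) (Fin K) ℂ) (c : ℕ → Fin K → ℂ) (S : Finset ℕ)
    (hS : ∀ j ∈ S, j < K) {k : ℕ} (hk : k ∈ S) (r : ℂ) (w : Fin K → ℂ) (hw : A *ᵥ c k = r • w)
    (h : ∀ j ∈ S, j ≠ k → ∃ i < K, i ≠ j ∧ ∃ q : ℂ, A *ᵥ c j = q • c i) :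
    ∑ j ∈ S, colDet (Function.update c j (A *ᵥ c j)) = r * colDet (Function.update c k w) := by
  rw [Finset.sum_eq_single k, hw, colDet_update_smul _ (hS k hk)]
  · intro j hj hjk
    obtain ⟨i, hi, hij, q, hq⟩ := h j hj hjk
    rw [hq, colDet_update_smul _ (hS j hj),
      colDet_eq_zero hi (hS j hj) hij (by simp [hij]), mul_zero]
  · exact fun h' => absurd hk h'

/-- The product rule applied to every term of the Leibniz expansion, followed by an interchange of
the two sums. -/
theorem hasDerivAt_colDet {c : ℕ → ℝ → Fin K → ℂ} {c' : ℕ → Fin K → ℂ} {y : ℝ}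
    (h : ∀ j < K, HasDerivAt (c j) (c' j) y) :
    HasDerivAt (fun y => colDet fun j => c j y)
      (∑ j ∈ Finset.range K, colDet (Function.update (fun i => c i y) j (c' j))) y := by
  have hd : ∀ i j : Fin K, HasDerivAt (fun y => c j y i) (c' j i) y := fun i j =>
    hasDerivAt_pi.1 (h j j.2) i
  have hp : ∀ σ : Equiv.Perm (Fin K),
      HasDerivAt (fun y => ((Equiv.Perm.sign σ : ℤ) : ℂ) * ∏ j : Fin K, c j y (σ j))
        (((Equiv.Perm.sign σ : ℤ) : ℂ) *
          ∑ j : Fin K, (∏ i ∈ Finset.univ.erase j, c i y (σ i)) • c' j (σ j)) y := fun σ =>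
    (HasDerivAt.fun_finsetProd fun j _ => hd (σ j) j).const_mul _
  have hs := HasDerivAt.fun_sum (u := Finset.univ) fun σ _ => hp σ
  simp only [colDet, Matrix.det_apply']
  refine hs.congr_deriv ?_
  rw [Finset.sum_range fun j => ∑ σ : Equiv.Perm (Fin K), ((Equiv.Perm.sign σ : ℤ) : ℂ) *
      ∏ i : Fin K, (Matrix.of fun l i : Fin K =>
        Function.update (fun i => c i y) j (c' j) i l) (σ i) i, Finset.sum_comm]
  refine Finset.sum_congr rfl fun σ _ => ?_
  rw [Finset.mul_sum]
  refine Finset.sum_congr rfl fun j _ => ?_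
  rw [← Finset.mul_prod_erase Finset.univ _ (Finset.mem_univ j)]
  simp only [Matrix.of_apply, Function.update_self, smul_eq_mul]
  rw [mul_comm (c' j (σ j))]
  congr 2
  refine Finset.prod_congr rfl fun i hi => ?_
  have : (i : ℕ) ≠ j := fun e => Finset.ne_of_mem_erase hi (Fin.ext e)
  rw [Function.update_of_ne this]

end ColDet

/-! ### Column sequences made of two blocks -/

/-- The sequence `φ a, …, φ (a + n - 1), ψ b, ψ (b + 1), …`. -/
def blocks {V : Type*} (φ ψ : ℕ → V) (a n b : ℕ) : ℕ → V :=
  fun j => if j < n then φ (a + j) else ψ (b + (j - n))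

section Blocks

variable {V : Type*} (φ ψ : ℕ → V)

theorem blocks_fst {a n b j : ℕ} (i : ℕ) (h : j < n) (hi : a + j = i) :
    blocks φ ψ a n b j = φ i := by
  simp [blocks, h, hi]

theorem blocks_snd {a n b j : ℕ} (i : ℕ) (h : n ≤ j) (hi : b + (j - n) = i) :
    blocks φ ψ a n b j = ψ i := by
  simp [blocks, not_lt.2 h, hi]

end Blocks

/-! ### Plücker identities for double Wronskians -/

section Identities

open Function

variable {K N M : ℕ} (φ ψ : ℕ → Fin K → ℂ)

/-- Exchange the column `φ 1` of the second factor: only `φ 0` and `ψ 0` of the first factor are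
missing from its other columns, and the two reordering signs `(-1)^(N-1)` cancel. The last column
`w` stays free because `ψ M` is needed for `D_t f·s` and `ψ (M + 1)` for its differentiated
companion. -/
theorem colDet_blocks_plucker (hK : N + M = K) (hN : 1 ≤ N) (hM : 1 ≤ M) (w : Fin K → ℂ) :
    colDet (update (blocks φ ψ 1 N 0) 0 (φ 0)) *
        colDet (update (blocks φ ψ 1 N 1) (K - 1) w) =
      colDet (blocks φ ψ 1 N 0) * colDet (update (update (blocks φ ψ 1 N 1) (K - 1) w) 0 (φ 0)) +
      colDet (blocks φ ψ 0 (N + 1) 1) * colDet (update (blocks φ ψ 2 (N - 1) 0) (K - 1) w) := by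
  have hB0 : update (blocks φ ψ 1 N 1) (K - 1) w 0 = φ 1 := by
    rw [update_of_ne (by omega), blocks_fst φ ψ 1 (by omega) (by omega)]
  have hAN : update (blocks φ ψ 1 N 0) 0 (φ 0) N = ψ 0 := by
    rw [update_of_ne (by omega), blocks_snd φ ψ 0 (by omega) (by omega)]
  rw [colDet_exchange_two _ _ (k := 0) (p := 0) (q := N) (by omega) (by omega) (by omega)
    (by omega)]
  · rw [hB0, hAN, update_self, update_idem]
    congr 1
    · congr 2
      rw [update_eq_self_iff, blocks_fst φ ψ 1 (by omega) (by omega)]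
    · have h1 : colDet (update (update (blocks φ ψ 1 N 0) 0 (φ 0)) N (φ 1)) =
          (-1) ^ (N - 1) * colDet (blocks φ ψ 0 (N + 1) 1) := by
        refine colDet_move 1 (N - 1) _ _ (by omega) ?_ ?_ ?_ ?_
        · intro k hk
          obtain rfl : k = 0 := by omega
          rw [update_of_ne (by omega), update_self, blocks_fst φ ψ 0 (by omega) (by omega)]
        · intro k hk hk2
          rw [update_of_ne (by omega), update_of_ne (by omega),
            blocks_fst φ ψ (k + 1) (by omega) (by omega),
            blocks_fst φ ψ (k + 1) (by omega) (by omega)]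
        · rw [show 1 + (N - 1) = N by omega, update_self,
            blocks_fst φ ψ 1 (by omega) (by omega)]
        · intro k hk hk2
          rw [update_of_ne (by omega), update_of_ne (by omega),
            blocks_snd φ ψ (k - N) (by omega) (by omega),
            blocks_snd φ ψ (k - N) (by omega) (by omega)]
      have h2 : colDet (update (blocks φ ψ 2 (N - 1) 0) (K - 1) w) =
          (-1) ^ (N - 1) * colDet (update (update (blocks φ ψ 1 N 1) (K - 1) w) 0 (ψ 0)) := by
        refine colDet_move 0 (N - 1) _ _ (by omega) ?_ ?_ ?_ ?_
        · intro k hk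
          omega
        · intro k hk hk2
          rw [update_of_ne (by omega), update_of_ne (by omega), update_of_ne (by omega),
            blocks_fst φ ψ (k + 2) (by omega) (by omega),
            blocks_fst φ ψ (k + 2) (by omega) (by omega)]
        · rw [zero_add, update_of_ne (by omega), update_self,
            blocks_snd φ ψ 0 (by omega) (by omega)]
        · intro k hk hk2
          rw [update_of_ne (a := k) (a' := 0) (by omega)]
          by_cases hk3 : k = K - 1
          · rw [hk3, update_self, update_self]
          · rw [update_of_ne hk3, update_of_ne hk3,
              blocks_snd φ ψ (k - N + 1) (by omega) (by omega),
              blocks_snd φ ψ (k - N + 1) (by omega) (by omega)]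
      rw [h1, h2]
      ring
  · intro i hi hi0 hiN
    by_cases h : i < N
    · refine ⟨i, hi, hi0, ?_⟩
      rw [update_of_ne (by omega), update_of_ne hi0, blocks_fst φ ψ (i + 1) h (by omega),
        blocks_fst φ ψ (i + 1) h (by omega)]
    · refine ⟨i - 1, by omega, by omega, ?_⟩
      rw [update_of_ne (by omega), update_of_ne hi0, blocks_snd φ ψ (i - N) (by omega) (by omega),
        blocks_snd φ ψ (i - N) (by omega) (by omega)]

/-- Exchange the column `φ (N + 1)` of the second factor: `φ 1, …, φ (N - 1)` are common to both
factors and `h` provides the tail of the first, so only `φ 0` and `φ N` contribute. Reordering costs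
`(-1)^N` and `(-1)^(N-1)`, whence the minus sign. -/
theorem colDet_blocks_exchange (α β : ℕ → Fin K → ℂ) (hN : 1 ≤ N) (hNK : N + 1 ≤ K)
    (h : ∀ i, i + N + 1 < K → ∃ j, j + N < K ∧ β j = α i) :
    colDet (blocks φ α 0 (N + 1) 0) * colDet (update (blocks φ β 1 N 0) (N - 1) (φ (N + 1))) =
      colDet (update (blocks φ α 0 (N + 1) 0) N (φ (N + 1))) * colDet (blocks φ β 1 N 0) -
      colDet (blocks φ α 1 (N + 1) 0) * colDet (blocks φ β 0 N 0) := by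
  have h1 : colDet (blocks φ α 1 (N + 1) 0) =
      (-1) ^ N * colDet (update (blocks φ α 0 (N + 1) 0) 0 (φ (N + 1))) := by
    refine colDet_move 0 N _ _ (by omega) (fun k hk => by omega) ?_ ?_ ?_
    · intro k hk hk2
      rw [update_of_ne (by omega), blocks_fst φ α (k + 1) (by omega) (by omega),
        blocks_fst φ α (k + 1) (by omega) (by omega)]
    · rw [zero_add, update_self, blocks_fst φ α (N + 1) (by omega) (by omega)]
    · intro k hk hk2
      rw [update_of_ne (by omega), blocks_snd φ α (k - (N + 1)) (by omega) (by omega),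
        blocks_snd φ α (k - (N + 1)) (by omega) (by omega)]
  have h2 : colDet (update (blocks φ β 1 N 0) (N - 1) (φ 0)) =
      (-1) ^ (N - 1) * colDet (blocks φ β 0 N 0) := by
    refine colDet_move 0 (N - 1) _ _ (by omega) (fun k hk => by omega) ?_ ?_ ?_
    · intro k hk hk2
      rw [update_of_ne (by omega), blocks_fst φ β (k + 1) (by omega) (by omega),
        blocks_fst φ β (k + 1) (by omega) (by omega)]
    · rw [zero_add, update_self, blocks_fst φ β 0 (by omega) (by omega)]
    · intro k hk hk2
      rw [update_of_ne (by omega), blocks_snd φ β (k - N) (by omega) (by omega),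
        blocks_snd φ β (k - N) (by omega) (by omega)]
  rw [colDet_exchange_two _ _ (k := N - 1) (p := 0) (q := N) (by omega) (by omega) (by omega)
    (by omega)]
  · rw [update_self, update_idem, update_idem,
      blocks_fst φ α 0 (show 0 < N + 1 by omega) (by omega),
      blocks_fst φ α N (show N < N + 1 by omega) (by omega),
      show update (blocks φ β 1 N 0) (N - 1) (φ N) = blocks φ β 1 N 0 by
        rw [update_eq_self_iff, blocks_fst φ β N (by omega) (by omega)], h1, h2]
    have h3 : (-1 : ℂ) ^ N = -(-1) ^ (N - 1) := by
      conv_lhs => rw [show N = N - 1 + 1 by omega, pow_succ, mul_neg_one]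
    rw [h3]
    ring
  · intro i hi hi0 hiN
    by_cases hi2 : i < N
    · refine ⟨i - 1, by omega, by omega, ?_⟩
      rw [update_of_ne (by omega), blocks_fst φ β i (by omega) (by omega),
        blocks_fst φ α i (by omega) (by omega)]
    · obtain ⟨j, hj, hji⟩ := h (i - (N + 1)) (by omega)
      refine ⟨j + N, hj, by omega, ?_⟩
      rw [update_of_ne (by omega), blocks_snd φ β j (by omega) (by omega),
        blocks_snd φ α (i - (N + 1)) (by omega) (by omega), hji]

/-- `L` acts on all columns at once: it raises each index by one, with a factor -1 for each column
of the second block. -/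
theorem det_mul_colDet_blocks (L : Matrix (Fin K) (Fin K) ℂ) (α α' : ℕ → Fin K → ℂ) (n : ℕ)
    (hφ : ∀ k, L *ᵥ φ k = φ (k + 1)) (hα : ∀ k, L *ᵥ α k = -α' k) :
    L.det * colDet (blocks φ α 0 n 0) =
      (∏ j ∈ Finset.range K, if j < n then (1 : ℂ) else -1) * colDet (blocks φ α' 1 n 0) := by
  rw [← colDet_mulVec, ← colDet_smul]
  refine colDet_congr fun j _ => ?_
  by_cases h : j < n
  · rw [if_pos h, one_smul, blocks_fst φ α j h (by omega), blocks_fst φ α' (j + 1) h (by omega), hφ]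
  · rw [if_neg h, neg_one_smul, blocks_snd φ α (j - n) (by omega) (by omega),
      blocks_snd φ α' (j - n) (by omega) (by omega), hα]

theorem prod_range_ite_neg_one {n : ℕ} (hn : n < K) :
    (∏ j ∈ Finset.range K, if j < n then (1 : ℂ) else -1) =
      -∏ j ∈ Finset.range K, if j < n + 1 then (1 : ℂ) else -1 := by
  rw [← Finset.mul_prod_erase _ _ (Finset.mem_range.2 hn),
    ← Finset.mul_prod_erase (Finset.range K) (fun j => if j < n + 1 then (1 : ℂ) else -1)
      (Finset.mem_range.2 hn)]
  simp only [lt_irrefl, if_false, lt_add_one, if_true, neg_mul, one_mul]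
  congr 1
  refine Finset.prod_congr rfl fun j hj => ?_
  have := Finset.ne_of_mem_erase hj
  by_cases h : j < n
  · rw [if_pos h, if_pos (by omega)]
  · rw [if_neg h, if_neg (by omega)]

theorem update_blocks (ψ : ℕ → Fin K → ℂ) (a n b i : ℕ) (v : Fin K → ℂ) :
    update (blocks φ ψ a n b) (n + i) v = blocks φ (update (fun k => ψ (b + k)) i v) a n 0 := by
  funext j
  by_cases hj : j < n
  · rw [update_of_ne (by omega), blocks_fst φ ψ (a + j) hj rfl, blocks_fst _ _ (a + j) hj rfl]
  · rw [blocks_snd _ _ (j - n) (by omega) (by omega)]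
    by_cases hi : j = n + i
    · rw [hi, update_self, show n + i - n = i by omega, update_self]
    · rw [update_of_ne hi, update_of_ne (by omega), blocks_snd _ _ _ (by omega) rfl]

theorem blocks_eq (ψ : ℕ → Fin K → ℂ) (a n b : ℕ) :
    blocks φ ψ a n b = blocks φ (fun k => ψ (b + k)) a n 0 := by
  funext j
  simp [blocks]

variable {L : Matrix (Fin K) (Fin K) ℂ}

/-- Feeds the exchange of `|1,…,N+1; 2,3,…|` with `|1,…,N; 1,3,…|`: only `φ (N + 1)` and `ψ 2` of
the former can be absent from the columns of the latter other than `ψ 1`. -/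
theorem exists_blocks_shifted {c : ℕ → Fin K → ℂ} (hc : c = blocks φ ψ 1 (N + 1) 2)
    (hN : 1 ≤ N) (i : ℕ) (hi : i < K) (hiN : i ≠ N) (hiN1 : i ≠ N + 1) :
    ∃ j < K, j ≠ N ∧ blocks φ (update (fun k => ψ (2 + k)) 0 (ψ 1)) 1 N 0 j = c i := by
  subst hc
  by_cases h : i < N
  · refine ⟨i, hi, hiN, ?_⟩
    rw [blocks_fst _ _ (1 + i) h rfl, blocks_fst _ _ (1 + i) (by omega) rfl]
  · refine ⟨i - 1, by omega, by omega, ?_⟩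
    rw [blocks_snd _ _ (i - 1 - N) (by omega) (by omega), update_of_ne (by omega),
      blocks_snd φ ψ (2 + (i - 1 - N)) (by omega) (by omega)]

theorem update_blocks_fst_last :
    update (blocks φ ψ 1 (N + 1) 2) N (ψ 1) = blocks φ ψ 1 N 1 := by
  funext j
  rcases lt_trichotomy j N with h | rfl | h
  · rw [update_of_ne h.ne, blocks_fst _ _ (1 + j) (by omega) rfl, blocks_fst _ _ (1 + j) h rfl]
  · rw [update_self, blocks_snd _ _ 1 le_rfl (by omega)]
  · rw [update_of_ne h.ne', blocks_snd φ ψ (j - N + 1) (by omega) (by omega),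
      blocks_snd φ ψ (j - N + 1) (by omega) (by omega)]

theorem update_blocks_snd_first :
    update (blocks φ (update (fun k => ψ (2 + k)) 0 (ψ 1)) 1 N 0) N (φ (N + 1)) =
      blocks φ ψ 1 (N + 1) 3 := by
  funext j
  rcases lt_trichotomy j N with h | rfl | h
  · rw [update_of_ne h.ne, blocks_fst _ _ (1 + j) h rfl, blocks_fst _ _ (1 + j) (by omega) rfl]
  · rw [update_self, blocks_fst φ ψ (j + 1) (by omega) (by omega)]
  · rw [update_of_ne h.ne', blocks_snd _ _ (j - N) (by omega) (by omega),
      update_of_ne (by omega), blocks_snd φ ψ (2 + (j - N)) (by omega) (by omega)]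

variable {L : Matrix (Fin K) (Fin K) ℂ}

theorem det_mul_colDet_blocks_modified (hφ : ∀ k, L *ᵥ φ k = φ (k + 1))
    (hψ : ∀ k, L *ᵥ ψ k = -ψ (k + 1)) (n : ℕ) :
    L.det * colDet (blocks φ (update (fun k => ψ (1 + k)) 0 (ψ 0)) 0 n 0) =
      (∏ j ∈ Finset.range K, if j < n then (1 : ℂ) else -1) *
        colDet (blocks φ (update (fun k => ψ (2 + k)) 0 (ψ 1)) 1 n 0) := by
  refine det_mul_colDet_blocks φ L _ _ n hφ fun k => ?_
  rcases Nat.eq_zero_or_pos k with rfl | hk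
  · simp [hψ]
  · rw [update_of_ne hk.ne', update_of_ne hk.ne', hψ]
    congr 2
    omega

/-- The algebraic form of `D_x D_t g · f + g f = 0`. -/
theorem colDet_blocks_two (hL : L.det ≠ 0) (hφ : ∀ k, L *ᵥ φ k = φ (k + 1))
    (hψ : ∀ k, L *ᵥ ψ k = -ψ (k + 1)) (hN : 1 ≤ N) (hK : N + 2 ≤ K) :
    colDet (update (update (blocks φ ψ 0 (N + 1) 2) (N + 1) (ψ 1)) N (φ (N + 1))) *
        colDet (blocks φ ψ 1 N 1) +
      colDet (blocks φ ψ 0 (N + 1) 2) *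
        colDet (update (update (blocks φ ψ 1 N 1) N (ψ 0)) (N - 1) (φ (N + 1))) -
      colDet (update (blocks φ ψ 0 (N + 1) 2) N (φ (N + 1))) *
        colDet (update (blocks φ ψ 1 N 1) N (ψ 0)) -
      colDet (update (blocks φ ψ 0 (N + 1) 2) (N + 1) (ψ 1)) *
        colDet (update (blocks φ ψ 1 N 1) (N - 1) (φ (N + 1))) =
      colDet (blocks φ ψ 0 (N + 1) 2) * colDet (blocks φ ψ 1 N 1) := by
  have u1 := update_blocks φ ψ 0 (N + 1) 2 0 (ψ 1)
  have u2 := update_blocks φ ψ 1 N 1 0 (ψ 0)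
  rw [add_zero] at u1 u2
  -- `e1` and `e2` reduce the left side to `|1,…,N+1; 1,3,…| |0,…,N-1; 1,2,…| - |1,…,N+1; 2,3,…|
  -- |0,…,N-1; 0,2,…|`.
  have e1 := colDet_blocks_exchange φ (fun k => ψ (2 + k))
    (update (fun k => ψ (1 + k)) 0 (ψ 0)) hN (by omega) fun i hi =>
      ⟨i + 1, by omega, by rw [update_of_ne (by omega)]; congr 1; omega⟩
  have e2 := colDet_blocks_exchange φ (update (fun k => ψ (2 + k)) 0 (ψ 1))
    (fun k => ψ (1 + k)) hN (by omega) fun i hi => ⟨if i = 0 then 0 else i + 1, by split_ifs <;> omega, by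
      split_ifs with h
      · simp [h]
      · rw [update_of_ne h]; congr 1; omega⟩
  -- Multiplication by `det L` shifts the factors that start at `φ 0` (`s1`, `s2`, `s3`); what
  -- remains is the three-term relation `e3`. The factor `|0,…,N; 2,…|` has one more `φ` column than
  -- the other two, hence the opposite sign from `prod_range_ite_neg_one`.
  have e3 := colDet_exchange_two (blocks φ ψ 1 (N + 1) 2)
    (blocks φ (update (fun k => ψ (2 + k)) 0 (ψ 1)) 1 N 0) (k := N) (p := N) (q := N + 1)
    (by omega) (by omega) (by omega) (by omega)
    (exists_blocks_shifted φ ψ rfl hN)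
  have u3 := update_blocks φ ψ 1 (N + 1) 2 0 (ψ 1)
  have u4 := update_blocks φ (update (fun k => ψ (2 + k)) 0 (ψ 1)) 1 N 0 0 (ψ 2)
  simp only [add_zero, zero_add, update_idem] at u3 u4
  have u5 : update (fun k => ψ (2 + k)) 0 (ψ 2) = fun k => ψ (2 + k) := by
    rw [update_eq_self_iff]
  rw [u5, ← blocks_eq] at u4
  rw [blocks_snd _ _ 0 le_rfl (by omega), update_self, blocks_fst φ ψ (N + 1) (by omega) (by omega),
    blocks_snd φ ψ 2 (by omega) (by omega), update_blocks_fst_last, update_blocks_snd_first, u3, u4]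
    at e3
  have s1 := det_mul_colDet_blocks_modified φ ψ hφ hψ N
  have s2 := det_mul_colDet_blocks φ L (fun k => ψ (1 + k)) (fun k => ψ (2 + k)) N hφ fun k => by
    rw [hψ]; congr 2; omega
  have s3 := det_mul_colDet_blocks φ L (fun k => ψ (2 + k)) (fun k => ψ (3 + k)) (N + 1) hφ
    fun k => by rw [hψ]; congr 2; omega
  rw [prod_range_ite_neg_one (by omega)] at s1 s2
  simp only [← blocks_eq] at e1 e2 s1 s2 s3
  rw [u1, u2]
  refine mul_left_cancel₀ hL ?_
  linear_combination L.det * e1 - L.det * e2 +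
    colDet (blocks φ (update (fun k => ψ (2 + k)) 0 (ψ 1)) 1 (N + 1) 0) * s2 -
    colDet (blocks φ ψ 1 (N + 1) 2) * s1 +
    (∏ j ∈ Finset.range K, if j < N + 1 then (1 : ℂ) else -1) * e3 - colDet (blocks φ ψ 1 N 1) * s3

/-- The algebraic form of `D_x D_t g · f + g f = 0` when `g` has no column from `ψ`. -/
theorem colDet_blocks_one (hL : L.det ≠ 0) (hφ : ∀ k, L *ᵥ φ k = φ (k + 1))
    (hψ : ∀ k, L *ᵥ ψ k = -ψ (k + 1)) (hN : 1 ≤ N) (hK : N + 1 = K) :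
    colDet (blocks φ ψ 0 (N + 1) 2) *
        colDet (update (update (blocks φ ψ 1 N 1) N (ψ 0)) (N - 1) (φ (N + 1))) -
      colDet (update (blocks φ ψ 0 (N + 1) 2) N (φ (N + 1))) *
        colDet (update (blocks φ ψ 1 N 1) N (ψ 0)) =
      colDet (blocks φ ψ 0 (N + 1) 2) * colDet (blocks φ ψ 1 N 1) := by
  have u2 := update_blocks φ ψ 1 N 1 0 (ψ 0)
  rw [add_zero] at u2
  have e1 := colDet_blocks_exchange φ (fun k => ψ (2 + k))
    (update (fun k => ψ (1 + k)) 0 (ψ 0)) hN (by omega) fun i hi => by omega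
  -- With `K = N + 1` the column `ψ 2` lies beyond the determinant, so the second term of the
  -- exchange is absent.
  have e3 := colDet_exchange_one (blocks φ ψ 1 (N + 1) 2)
    (blocks φ (update (fun k => ψ (2 + k)) 0 (ψ 1)) 1 N 0) (k := N) (p := N)
    (by omega) (by omega)
    fun i hi hiN => exists_blocks_shifted φ ψ rfl hN i hi hiN (by omega)
  rw [blocks_snd _ _ 0 le_rfl (by omega), update_self, blocks_fst φ ψ (N + 1) (by omega) (by omega),
    update_blocks_fst_last, update_blocks_snd_first] at e3
  have s1 := det_mul_colDet_blocks_modified φ ψ hφ hψ N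
  have s3 := det_mul_colDet_blocks φ L (fun k => ψ (2 + k)) (fun k => ψ (3 + k)) (N + 1) hφ
    fun k => by rw [hψ]; congr 2; omega
  rw [prod_range_ite_neg_one (by omega)] at s1
  simp only [← blocks_eq] at e1 s1 s3
  rw [u2]
  refine mul_left_cancel₀ hL ?_
  linear_combination L.det * e1 - colDet (blocks φ ψ 1 (N + 1) 2) * s1 +
    (∏ j ∈ Finset.range K, if j < N + 1 then (1 : ℂ) else -1) * e3 - colDet (blocks φ ψ 1 N 1) * s3

end Identities

/-! ### Partial derivatives of smooth functions -/

section Smooth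

variable {E : Type*} [NormedAddCommGroup E] [NormedSpace ℝ E] {F : ℝ → ℝ → E}

theorem IsSmooth.hasDerivAt_fst (hF : IsSmooth F) (x t : ℝ) :
    HasDerivAt (fun y => F y t) (fderiv ℝ (fun p : ℝ × ℝ => F p.1 p.2) (x, t) (1, 0)) x := by
  have h1 : HasFDerivAt (fun p : ℝ × ℝ => F p.1 p.2) _ (x, t) :=
    (hF.differentiable (by simp) (x, t)).hasFDerivAt
  exact h1.comp_hasDerivAt x ((hasDerivAt_id x).prodMk (hasDerivAt_const x t))

theorem IsSmooth.hasDerivAt_snd (hF : IsSmooth F) (x t : ℝ) :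
    HasDerivAt (fun r => F x r) (fderiv ℝ (fun p : ℝ × ℝ => F p.1 p.2) (x, t) (0, 1)) t := by
  have h1 : HasFDerivAt (fun p : ℝ × ℝ => F p.1 p.2) _ (x, t) :=
    (hF.differentiable (by simp) (x, t)).hasFDerivAt
  exact h1.comp_hasDerivAt t ((hasDerivAt_const t x).prodMk (hasDerivAt_id t))

theorem IsSmooth.hasDerivAt_pdx (hF : IsSmooth F) (x t : ℝ) :
    HasDerivAt (fun y => F y t) (pdx F x t) x :=
  (hF.hasDerivAt_fst x t).differentiableAt.hasDerivAt

theorem IsSmooth.hasDerivAt_pdt (hF : IsSmooth F) (x t : ℝ) :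
    HasDerivAt (fun r => F x r) (pdt F x t) t :=
  (hF.hasDerivAt_snd x t).differentiableAt.hasDerivAt

theorem IsSmooth.fderiv_apply (hF : IsSmooth F) (v : ℝ × ℝ) :
    ContDiff ℝ ∞ fun p : ℝ × ℝ => fderiv ℝ (fun p : ℝ × ℝ => F p.1 p.2) p v :=
  (hF.fderiv_right (m := ∞) (by simp)).clm_apply contDiff_const

theorem IsSmooth.pdx_eq (hF : IsSmooth F) :
    pdx F = fun x t => fderiv ℝ (fun p : ℝ × ℝ => F p.1 p.2) (x, t) (1, 0) := by
  funext x t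
  exact (hF.hasDerivAt_fst x t).deriv

theorem IsSmooth.pdt_eq (hF : IsSmooth F) :
    pdt F = fun x t => fderiv ℝ (fun p : ℝ × ℝ => F p.1 p.2) (x, t) (0, 1) := by
  funext x t
  exact (hF.hasDerivAt_snd x t).deriv

theorem IsSmooth.pdx (hF : IsSmooth F) : IsSmooth (pdx F) := by
  rw [hF.pdx_eq]
  exact hF.fderiv_apply (1, 0)

theorem IsSmooth.pdt (hF : IsSmooth F) : IsSmooth (pdt F) := by
  rw [hF.pdt_eq]
  exact hF.fderiv_apply (0, 1)

theorem IsSmooth.pdx_pdt (hF : IsSmooth F) : _root_.pdx (_root_.pdt F) = _root_.pdt (_root_.pdx F) := by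
  funext x t
  have hd : DifferentiableAt ℝ (fderiv ℝ fun p : ℝ × ℝ => F p.1 p.2) (x, t) :=
    ((hF.fderiv_right (m := ∞) (by simp)).differentiable (by simp)) (x, t)
  have hs : IsSymmSndFDerivAt ℝ (fun p : ℝ × ℝ => F p.1 p.2) (x, t) :=
    hF.contDiffAt.isSymmSndFDerivAt (by
      rw [minSmoothness_of_isRCLikeNormedField]
      exact WithTop.coe_le_coe.2 (le_top : (2 : ℕ∞) ≤ ⊤))
  have key : ∀ v w : ℝ × ℝ, fderiv ℝ
      (fun p : ℝ × ℝ => fderiv ℝ (fun p : ℝ × ℝ => F p.1 p.2) p v) (x, t) w =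
      fderiv ℝ (fderiv ℝ fun p : ℝ × ℝ => F p.1 p.2) (x, t) w v := fun v w => by
    rw [fderiv_clm_apply hd (differentiableAt_const v)]
    simp
  rw [hF.pdt.pdx_eq, hF.pdx.pdt_eq, hF.pdt_eq, hF.pdx_eq]
  simp only [key]
  exact hs (1, 0) (0, 1)

theorem IsSmooth.pdx_iterate (hF : IsSmooth F) (k : ℕ) : IsSmooth (_root_.pdx^[k] F) := by
  induction k generalizing F with
  | zero => exact hF
  | succ k ih => exact ih hF.pdx

end Smooth

/-! ### Hirota derivatives of low order -/

section Hirota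

variable {a b : ℝ → ℝ → ℂ}

theorem hirota_zero_one (a b : ℝ → ℝ → ℂ) (x t : ℝ) :
    hirota 0 1 a b x t = pdt a x t * b x t - a x t * pdt b x t := by
  simp only [hirota, Function.iterate_one, Function.iterate_zero, id, hirotaT,
    deriv_mul_const_field, deriv_const_mul_field]
  rfl

theorem hirota_one_zero (a b : ℝ → ℝ → ℂ) (x t : ℝ) :
    hirota 1 0 a b x t = pdx a x t * b x t - a x t * pdx b x t := by
  simp only [hirota, Function.iterate_one, Function.iterate_zero, id, hirotaX,
    deriv_mul_const_field, deriv_const_mul_field]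
  rfl

theorem hirota_one_one (ha : IsSmooth a) (hb : IsSmooth b) (x t : ℝ) :
    hirota 1 1 a b x t = pdx (pdt a) x t * b x t - pdx a x t * pdt b x t -
      pdt a x t * pdx b x t + a x t * pdx (pdt b) x t := by
  simp only [hirota, Function.iterate_one, hirotaX, hirotaT,
    deriv_mul_const_field, deriv_const_mul_field]
  have h1 := ((ha.pdt.hasDerivAt_pdx x t).mul_const (b x t)).sub
    ((ha.hasDerivAt_pdx x t).mul_const (pdt b x t))
  have h2 := ((hb.hasDerivAt_pdx x t).const_mul (pdt a x t)).sub
    ((hb.pdt.hasDerivAt_pdx x t).const_mul (a x t))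
  have e1 := h1.deriv
  have e2 := h2.deriv
  simp only [Pi.sub_def] at e1 e2
  unfold pdt at e1 e2
  rw [e1, e2]
  unfold pdt
  ring

theorem hirota_const_mul (r q : ℂ) (a b : ℝ → ℝ → ℂ) (x t : ℝ) (ha : IsSmooth a) (hb : IsSmooth b) :
    hirota 1 1 (fun x t => r * a x t) (fun x t => q * b x t) x t = r * q * hirota 1 1 a b x t := by
  have h : ∀ (r : ℂ) {a : ℝ → ℝ → ℂ}, IsSmooth a → IsSmooth fun x t => r * a x t :=
    fun r _ ha => contDiff_const.mul ha
  have h1 : ∀ (r : ℂ) (a : ℝ → ℝ → ℂ),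
      pdt (fun x t => r * a x t) = fun x t => r * pdt a x t := fun r a => by
    funext x t
    exact deriv_const_mul_field r
  have h2 : ∀ (r : ℂ) (a : ℝ → ℝ → ℂ),
      pdx (fun x t => r * a x t) = fun x t => r * pdx a x t := fun r a => by
    funext x t
    exact deriv_const_mul_field r
  rw [hirota_one_one (h r ha) (h q hb), hirota_one_one ha hb]
  simp only [h1, h2]
  ring

end Hirota

/-! ### Reduction of pKN(-1) to the bilinear system -/

/-- From the bilinear system to the pKN(-1) system. -/
theorem IsBilinearSolution.isPKNSolutionOn {f g h s : ℝ → ℝ → ℂ}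
    (H : IsBilinearSolution f g h s) :
    IsPKNSolutionOn (fun x t => g x t / f x t) (fun x t => h x t / s x t)
      {p : ℝ × ℝ | f p.1 p.2 ≠ 0 ∧ s p.1 p.2 ≠ 0} := by
  obtain ⟨⟨hf, hg, hh, hs⟩, h1, h2, h3, h4⟩ := H
  have h4' : ∀ x t, pdt f x t * s x t - f x t * pdt s x t + I * (g x t * h x t) = 0 :=
    fun x t => by rw [← hirota_zero_one]; exact h4 x t
  -- The `x`-derivative of the fourth equation; its half-sum and half-difference with the third
  -- isolate `g_x h` and `g h_x`.
  have h4x : ∀ x t, pdx (pdt f) x t * s x t + pdt f x t * pdx s x t -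
      (pdx f x t * pdt s x t + f x t * pdx (pdt s) x t) +
      I * (pdx g x t * h x t + g x t * pdx h x t) = 0 := by
    intro x t
    have hd := ((((hf.pdt.hasDerivAt_pdx x t).mul (hs.hasDerivAt_pdx x t)).sub
      ((hf.hasDerivAt_pdx x t).mul (hs.pdt.hasDerivAt_pdx x t))).add
      (((hg.hasDerivAt_pdx x t).mul (hh.hasDerivAt_pdx x t)).const_mul I))
    refine hd.unique ((hasDerivAt_const x (0 : ℂ)).congr_of_eventuallyEq ?_)
    exact Filter.Eventually.of_forall fun y => h4' y t
  simp only [hirota_one_one hg hf] at h1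
  simp only [hirota_one_one hh hs] at h2
  simp only [hirota_one_one hf hs, hirota_one_zero] at h3
  have ho : IsOpen {p : ℝ × ℝ | f p.1 p.2 ≠ 0 ∧ s p.1 p.2 ≠ 0} :=
    (isOpen_ne_fun hf.continuous continuous_const).inter
      (isOpen_ne_fun hs.continuous continuous_const)
  have quot : ∀ {a b : ℝ → ℝ → ℂ}, IsSmooth a → IsSmooth b → ∀ x t, b x t ≠ 0 →
      pdx (fun x t => a x t / b x t) x t =
        (pdx a x t * b x t - a x t * pdx b x t) / b x t ^ 2 ∧
      pdt (pdx fun x t => a x t / b x t) x t =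
        ((pdx (pdt a) x t * b x t + pdx a x t * pdt b x t -
          (pdt a x t * pdx b x t + a x t * pdx (pdt b) x t)) * b x t ^ 2 -
          (pdx a x t * b x t - a x t * pdx b x t) * (2 * b x t * pdt b x t)) /
          (b x t ^ 2) ^ 2 := by
    intro a b ha hb x t hbx
    have hx : ∀ x t, b x t ≠ 0 → pdx (fun x t => a x t / b x t) x t =
        (pdx a x t * b x t - a x t * pdx b x t) / b x t ^ 2 := fun x t hbx =>
      ((ha.hasDerivAt_pdx x t).div (hb.hasDerivAt_pdx x t) hbx).deriv
    refine ⟨hx x t hbx, ?_⟩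
    have hev : ∀ᶠ r in nhds t, b x r ≠ 0 :=
      (hb.hasDerivAt_pdt x t).continuousAt.eventually_ne hbx
    rw [ha.pdx_pdt, hb.pdx_pdt]
    have hd := (((ha.pdx.hasDerivAt_pdt x t).mul (hb.hasDerivAt_pdt x t)).sub
      ((ha.hasDerivAt_pdt x t).mul (hb.pdx.hasDerivAt_pdt x t))).div
      ((hb.hasDerivAt_pdt x t).pow 2) (pow_ne_zero 2 hbx)
    refine (hd.congr_of_eventuallyEq (f₁ := fun r => pdx (fun x t => a x t / b x t) x r)
      (hev.mono fun r hr => hx x r hr)).deriv.trans ?_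
    simp
  refine ⟨ho, ?_, ?_, ?_⟩
  · simp only [div_eq_mul_inv]
    exact (ContDiff.contDiffOn hg).mul ((ContDiff.contDiffOn hf).inv fun p hp => hp.1)
  · simp only [div_eq_mul_inv]
    exact (ContDiff.contDiffOn hh).mul ((ContDiff.contDiffOn hs).inv fun p hp => hp.2)
  · rintro x t ⟨hfx, hsx⟩
    have hfx : f x t ≠ 0 := hfx
    have hsx : s x t ≠ 0 := hsx
    obtain ⟨q1, q2⟩ := quot hg hf x t hfx
    obtain ⟨q3, q4⟩ := quot hh hs x t hsx
    beta_reduce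
    rw [q1, q2, q3, q4]
    have e1 := h1 x t
    have e2 := h2 x t
    have e3 := h3 x t
    have e4 := h4' x t
    have e4x := h4x x t
    generalize pdx (pdt f) x t = fxt at *
    generalize pdx (pdt g) x t = gxt at *
    generalize pdx (pdt h) x t = hxt at *
    generalize pdx (pdt s) x t = sxt at *
    generalize pdx f x t = fx at *
    generalize pdx g x t = gx at *
    generalize pdx h x t = hx at *
    generalize pdx s x t = sx at *
    generalize pdt f x t = ft at *
    generalize pdt g x t = gt at *
    generalize pdt h x t = ht at *
    generalize pdt s x t = st at *
    generalize f x t = f at *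
    generalize g x t = g at *
    generalize h x t = h at *
    generalize s x t = s at *
    constructor
    -- After elimination of `s_t` by the fourth equation, `k2` says `(log f)_xt = -i v u_x`; its
    -- counterpart in the next case says `(log s)_xt = i u v_x`.
    · have k1 : fxt * s - fx * st = -I * gx * h := by
        linear_combination (e3 + e4x) / 2
      have k2 : s * (f * fxt - fx * ft) = -I * h * (gx * f - g * fx) := by
        linear_combination f * k1 - fx * e4
      field_simp
      linear_combination f * s * e1 - 2 * g * k2
    · have k1 : ft * sx - f * sxt = -I * g * hx := by
        linear_combination (e4x - e3) / 2
      have k2 : f * (s * sxt - sx * st) = I * g * (hx * s - h * sx) := by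
        linear_combination - s * k1 + sx * e4
      field_simp
      linear_combination f * s * e2 - 2 * h * k2

/-! ### Derivatives of determinants whose columns flow linearly -/

/-- A smooth vector with `v_x = ε L v` and `v_t = ε R v`. -/
structure ColumnFlow {K : ℕ} (L R : Matrix (Fin K) (Fin K) ℂ) (ε : ℂ) (v : ℝ → ℝ → Fin K → ℂ) :
    Prop where
  smooth : IsSmooth v
  pdx_eq : ∀ x t, pdx v x t = ε • (L *ᵥ v x t)
  pdt_eq : ∀ x t, pdt v x t = ε • (R *ᵥ v x t)

/-- The determinant of the first `K` members of a sequence of vector functions. -/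
noncomputable def colDetFn {K : ℕ} (c : ℕ → ℝ → ℝ → Fin K → ℂ) : ℝ → ℝ → ℂ :=
  fun x t => colDet fun j => c j x t

section Flow

open Function

variable {K : ℕ} {L R : Matrix (Fin K) (Fin K) ℂ}

theorem isSmooth_mulVec (A : Matrix (Fin K) (Fin K) ℂ) {v : ℝ → ℝ → Fin K → ℂ} (hv : IsSmooth v) :
    IsSmooth fun x t => A *ᵥ v x t := by
  refine contDiff_pi.2 fun i => ?_
  simp only [Matrix.mulVec, dotProduct]
  exact ContDiff.sum fun j _ => contDiff_const.mul (contDiff_pi.1 hv j)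

theorem hasDerivAt_mulVec (A : Matrix (Fin K) (Fin K) ℂ) {v : ℝ → Fin K → ℂ} {v' : Fin K → ℂ}
    {y : ℝ} (hv : HasDerivAt v v' y) : HasDerivAt (fun y => A *ᵥ v y) (A *ᵥ v') y := by
  refine hasDerivAt_pi.2 fun i => ?_
  simp only [Matrix.mulVec, dotProduct]
  exact HasDerivAt.fun_sum fun j _ => (hasDerivAt_pi.1 hv j).const_mul _

theorem ColumnFlow.mulVec {ε : ℂ} {v : ℝ → ℝ → Fin K → ℂ} (hv : ColumnFlow L R ε v)
    {A : Matrix (Fin K) (Fin K) ℂ} (hL : Commute A L) (hR : Commute A R) :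
    ColumnFlow L R ε fun x t => A *ᵥ v x t where
  smooth := isSmooth_mulVec A hv.smooth
  pdx_eq x t := by
    refine (hasDerivAt_mulVec A (hv.smooth.hasDerivAt_pdx x t)).deriv.trans ?_
    rw [hv.pdx_eq, Matrix.mulVec_smul, Matrix.mulVec_mulVec, Matrix.mulVec_mulVec, hL.eq]
  pdt_eq x t := by
    refine (hasDerivAt_mulVec A (hv.smooth.hasDerivAt_pdt x t)).deriv.trans ?_
    rw [hv.pdt_eq, Matrix.mulVec_smul, Matrix.mulVec_mulVec, Matrix.mulVec_mulVec, hR.eq]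

theorem ColumnFlow.neg {ε : ℂ} {v : ℝ → ℝ → Fin K → ℂ} (hv : ColumnFlow L R ε v) :
    ColumnFlow (-L) (-R) (-ε) v where
  smooth := hv.smooth
  pdx_eq x t := by rw [hv.pdx_eq, Matrix.neg_mulVec, smul_neg, neg_smul, neg_neg]
  pdt_eq x t := by rw [hv.pdt_eq, Matrix.neg_mulVec, smul_neg, neg_smul, neg_neg]

/-- The first `n` columns flow forwards and the remaining ones flow backwards. -/
def BlockFlow (L R : Matrix (Fin K) (Fin K) ℂ) (n : ℕ) (c : ℕ → ℝ → ℝ → Fin K → ℂ) : Prop :=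
  ∀ j < K, ColumnFlow L R (if j < n then 1 else -1) (c j)

variable {n : ℕ} {c : ℕ → ℝ → ℝ → Fin K → ℂ}

theorem BlockFlow.update (hc : BlockFlow L R n c) (k : ℕ) {w : ℝ → ℝ → Fin K → ℂ}
    (hw : ColumnFlow L R (if k < n then 1 else -1) w) : BlockFlow L R n (update c k w) := by
  intro j hj
  by_cases h : j = k
  · subst h
    rwa [update_self]
  · rw [update_of_ne h]
    exact hc j hj

theorem BlockFlow.isSmooth (hc : BlockFlow L R n c) : IsSmooth (colDetFn c) := by
  have h : ∀ i j : Fin K, ContDiff ℝ ∞ fun p : ℝ × ℝ => c j p.1 p.2 i := fun i j =>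
    contDiff_pi.1 (hc j j.2).smooth i
  simp only [IsSmooth, colDetFn, colDet, Matrix.det_apply']
  exact ContDiff.sum fun σ _ => contDiff_const.mul (contDiff_prod fun j _ => h (σ j) j)

theorem update_eval (c : ℕ → ℝ → ℝ → Fin K → ℂ) (k : ℕ) (w : ℝ → ℝ → Fin K → ℂ) (x t : ℝ) :
    (fun j => update c k w j x t) = update (fun j => c j x t) k (w x t) := by
  funext j
  by_cases h : j = k
  · subst h
    simp
  · simp [update_of_ne h]

theorem blocks_eval (φ ψ : ℕ → ℝ → ℝ → Fin K → ℂ) (a n b : ℕ) (x t : ℝ) :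
    (fun j => blocks φ ψ a n b j x t) =
      blocks (fun k => φ k x t) (fun k => ψ k x t) a n b := by
  funext j
  simp only [blocks]
  split_ifs <;> rfl

theorem sum_range_ite_smul (A : Matrix (Fin K) (Fin K) ℂ) (c : ℕ → Fin K → ℂ) (n : ℕ) :
    ∑ j ∈ Finset.range K, colDet (update c j ((if j < n then (1 : ℂ) else -1) • (A *ᵥ c j))) =
      ∑ j ∈ (Finset.range K).filter (· < n), colDet (update c j (A *ᵥ c j)) -
      ∑ j ∈ (Finset.range K).filter (fun j => ¬j < n), colDet (update c j (A *ᵥ c j)) := by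
  rw [← Finset.sum_filter_add_sum_filter_not _ (· < n), sub_eq_add_neg, ← Finset.sum_neg_distrib]
  congr 1
  · refine Finset.sum_congr rfl fun j hj => ?_
    rw [if_pos (Finset.mem_filter.1 hj).2, one_smul]
  · refine Finset.sum_congr rfl fun j hj => ?_
    obtain ⟨h1, h2⟩ := Finset.mem_filter.1 hj
    rw [if_neg h2, colDet_update_smul _ (Finset.mem_range.1 h1), neg_one_mul]

/-- The forward and backward sums add up to `tr A · det`, so their difference is twice the forward
sum minus the trace term. In the forward sum only column `k` survives, since `A` sends every other
forward column to a multiple of another column present. -/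
theorem sum_forward_sub_backward (A : Matrix (Fin K) (Fin K) ℂ) (c : ℕ → Fin K → ℂ) (n : ℕ)
    {k : ℕ} (hk : k < n) (hkK : k < K) (r : ℂ) (w : Fin K → ℂ) (hw : A *ᵥ c k = r • w)
    (h : ∀ j < n, j < K → j ≠ k → ∃ i < K, i ≠ j ∧ ∃ q : ℂ, A *ᵥ c j = q • c i) :
    ∑ j ∈ Finset.range K, colDet (update c j ((if j < n then (1 : ℂ) else -1) • (A *ᵥ c j))) =
      2 * r * colDet (update c k w) - A.trace * colDet c := by
  have h1 := sum_colDet_update_mulVec A c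
  have h2 := sum_colDet_update_eq A c ((Finset.range K).filter (· < n)) (by simp; omega)
    (by simp [hk, hkK]) r w hw (fun j hj => by
      simp only [Finset.mem_filter, Finset.mem_range] at hj
      exact h j hj.2 hj.1)
  rw [← Finset.sum_filter_add_sum_filter_not _ (· < n)] at h1
  rw [sum_range_ite_smul]
  linear_combination 2 * h2 - h1

theorem sum_forward_sub_backward' (A : Matrix (Fin K) (Fin K) ℂ) (c : ℕ → Fin K → ℂ) (n : ℕ)
    {k : ℕ} (hk : n ≤ k) (hkK : k < K) (r : ℂ) (w : Fin K → ℂ) (hw : A *ᵥ c k = r • w)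
    (h : ∀ j, n ≤ j → j < K → j ≠ k → ∃ i < K, i ≠ j ∧ ∃ q : ℂ, A *ᵥ c j = q • c i) :
    ∑ j ∈ Finset.range K, colDet (update c j ((if j < n then (1 : ℂ) else -1) • (A *ᵥ c j))) =
      A.trace * colDet c - 2 * r * colDet (update c k w) := by
  have h1 := sum_colDet_update_mulVec A c
  have h2 := sum_colDet_update_eq A c ((Finset.range K).filter (fun j => ¬j < n))
    (by simp; omega) (by simp [hk, hkK]) r w hw (fun j hj => by
      simp only [Finset.mem_filter, Finset.mem_range, not_lt] at hj
      exact h j hj.2 hj.1)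
  rw [← Finset.sum_filter_add_sum_filter_not _ (· < n)] at h1
  rw [sum_range_ite_smul]
  linear_combination h1 - 2 * h2

theorem BlockFlow.pdx_colDetFn (hc : BlockFlow L R n c) (x t : ℝ) :
    pdx (colDetFn c) x t = ∑ j ∈ Finset.range K, colDet (Function.update (fun i => c i x t) j
      ((if j < n then (1 : ℂ) else -1) • (L *ᵥ c j x t))) :=
  (hasDerivAt_colDet fun j hj => by
    rw [← (hc j hj).pdx_eq]
    exact (hc j hj).smooth.hasDerivAt_pdx x t).deriv

theorem BlockFlow.pdt_colDetFn (hc : BlockFlow L R n c) (x t : ℝ) :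
    pdt (colDetFn c) x t = ∑ j ∈ Finset.range K, colDet (Function.update (fun i => c i x t) j
      ((if j < n then (1 : ℂ) else -1) • (R *ᵥ c j x t))) :=
  (hasDerivAt_colDet fun j hj => by
    rw [← (hc j hj).pdt_eq]
    exact (hc j hj).smooth.hasDerivAt_pdt x t).deriv

theorem BlockFlow.pdx_forward (hc : BlockFlow L R n c) (hn : 1 ≤ n) (hnK : n ≤ K)
    {w : ℝ → ℝ → Fin K → ℂ} (hw : ∀ x t, L *ᵥ c (n - 1) x t = w x t)
    (h : ∀ j, j + 1 < n → ∀ x t, L *ᵥ c j x t = c (j + 1) x t) (x t : ℝ) :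
    pdx (colDetFn c) x t =
      2 * colDetFn (Function.update c (n - 1) w) x t - L.trace * colDetFn c x t := by
  rw [hc.pdx_colDetFn, sum_forward_sub_backward L (fun j => c j x t) n (k := n - 1) (by omega)
    (by omega) 1 (w x t) (by rw [hw, one_smul]), mul_one, ← update_eval]
  · rfl
  · exact fun j hj hjK hjk => ⟨j + 1, by omega, by omega, 1, by rw [h j (by omega), one_smul]⟩

theorem BlockFlow.pdx_backward (hc : BlockFlow L R n c) (hn : n < K)
    {w : ℝ → ℝ → Fin K → ℂ} (hw : ∀ x t, L *ᵥ c (K - 1) x t = -w x t)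
    (h : ∀ j, n ≤ j → j + 1 < K → ∀ x t, L *ᵥ c j x t = -c (j + 1) x t) (x t : ℝ) :
    pdx (colDetFn c) x t =
      2 * colDetFn (Function.update c (K - 1) w) x t + L.trace * colDetFn c x t := by
  rw [hc.pdx_colDetFn, sum_forward_sub_backward' L (fun j => c j x t) n (k := K - 1) (by omega)
    (by omega) (-1) (w x t) (by rw [hw, neg_one_smul]), ← update_eval]
  · simp only [colDetFn]
    ring
  · exact fun j hj hjK hjk =>
      ⟨j + 1, by omega, by omega, -1, by rw [h j hj (by omega), neg_one_smul]⟩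

/-- Lowering indices creates a new column only at the start of a block, whereas `∂_x` creates it at
the end. The coefficient `-1/2` is `2 · (-1/4)`. -/
theorem BlockFlow.pdt_forward (hc : BlockFlow L R n c) (hn : 1 ≤ n) (hnK : n ≤ K)
    {w : ℝ → ℝ → Fin K → ℂ} (hw : ∀ x t, R *ᵥ c 0 x t = (-(1 / 4) : ℂ) • w x t)
    (h : ∀ j, j + 1 < n → ∀ x t, R *ᵥ c (j + 1) x t = (-(1 / 4) : ℂ) • c j x t) (x t : ℝ) :
    pdt (colDetFn c) x t =
      -(1 / 2) * colDetFn (Function.update c 0 w) x t - R.trace * colDetFn c x t := by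
  rw [hc.pdt_colDetFn, sum_forward_sub_backward R (fun j => c j x t) n (k := 0) (by omega)
    (by omega) (-(1 / 4)) (w x t) (hw x t), ← update_eval]
  · simp only [colDetFn]
    ring
  · intro j hj hjK hjk
    obtain ⟨i, rfl⟩ := Nat.exists_eq_succ_of_ne_zero hjk
    exact ⟨i, by omega, by omega, _, h i hj x t⟩

theorem BlockFlow.pdt_backward (hc : BlockFlow L R n c) (hn : n < K)
    {w : ℝ → ℝ → Fin K → ℂ} (hw : ∀ x t, R *ᵥ c n x t = (1 / 4 : ℂ) • w x t)
    (h : ∀ j, n ≤ j → j + 1 < K → ∀ x t, R *ᵥ c (j + 1) x t = (1 / 4 : ℂ) • c j x t) (x t : ℝ) :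
    pdt (colDetFn c) x t =
      -(1 / 2) * colDetFn (Function.update c n w) x t + R.trace * colDetFn c x t := by
  rw [hc.pdt_colDetFn, sum_forward_sub_backward' R (fun j => c j x t) n (k := n) le_rfl
    (by omega) (1 / 4) (w x t) (hw x t), ← update_eval]
  · simp only [colDetFn]
    ring
  · intro j hj hjK hjk
    obtain ⟨i, rfl⟩ := Nat.exists_eq_succ_of_ne_zero (show j ≠ 0 by omega)
    exact ⟨i, by omega, by omega, _, h i (by omega) hjK x t⟩

theorem BlockFlow.pdt_of_forward (hc : BlockFlow L R K c) (x t : ℝ) :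
    pdt (colDetFn c) x t = R.trace * colDetFn c x t := by
  rw [hc.pdt_colDetFn, colDetFn, ← sum_colDet_update_mulVec]
  refine Finset.sum_congr rfl fun j hj => ?_
  rw [if_pos (Finset.mem_range.1 hj), one_smul]

theorem pdx_linear_comb {F G : ℝ → ℝ → ℂ} (hF : IsSmooth F) (hG : IsSmooth G) (p q : ℂ) (x t : ℝ) :
    pdx (fun x t => p * F x t + q * G x t) x t = p * pdx F x t + q * pdx G x t :=
  (((hF.hasDerivAt_pdx x t).const_mul p).add ((hG.hasDerivAt_pdx x t).const_mul q)).deriv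

/-! ### Bilinear equations for double Wronskians -/

/-- Two sequences of columns, linked by the recursions `∂_x φ_k = φ_{k+1}`,
`∂_t φ_{k+1} = -φ_k / 4` and their analogues for `ψ`. -/
structure FlowSystem (L R : Matrix (Fin K) (Fin K) ℂ) (φ ψ : ℕ → ℝ → ℝ → Fin K → ℂ) : Prop where
  fst : ∀ k, ColumnFlow L R 1 (φ k)
  snd : ∀ k, ColumnFlow L R (-1) (ψ k)
  fst_succ : ∀ k x t, L *ᵥ φ k x t = φ (k + 1) x t
  snd_succ : ∀ k x t, L *ᵥ ψ k x t = -ψ (k + 1) x t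
  fst_pred : ∀ k x t, R *ᵥ φ (k + 1) x t = (-(1 / 4) : ℂ) • φ k x t
  snd_pred : ∀ k x t, R *ᵥ ψ (k + 1) x t = (1 / 4 : ℂ) • ψ k x t

namespace FlowSystem

variable {φ ψ : ℕ → ℝ → ℝ → Fin K → ℂ}

/-- This symmetry carries the equation for `g·f` to the one for `h·s`. -/
theorem swap (h : FlowSystem L R φ ψ) : FlowSystem (-L) (-R) ψ φ where
  fst k := by simpa using (h.snd k).neg
  snd k := (h.fst k).neg
  fst_succ k x t := by rw [Matrix.neg_mulVec, h.snd_succ, neg_neg]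
  snd_succ k x t := by rw [Matrix.neg_mulVec, h.fst_succ]
  fst_pred k x t := by rw [Matrix.neg_mulVec, h.snd_pred, neg_smul]
  snd_pred k x t := by rw [Matrix.neg_mulVec, h.fst_pred, neg_smul, neg_neg]

theorem blockFlow (h : FlowSystem L R φ ψ) (a n b : ℕ) : BlockFlow L R n (blocks φ ψ a n b) := by
  intro j _
  by_cases hj : j < n
  · rw [if_pos hj, blocks_fst φ ψ (a + j) hj rfl]
    exact h.fst _
  · rw [if_neg hj, blocks_snd φ ψ _ (not_lt.1 hj) rfl]
    exact h.snd _

variable {N M : ℕ}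

theorem pdt_eq_of_forward (h : FlowSystem L R φ ψ) (hN : 1 ≤ N) (hNK : N ≤ K) (b : ℕ) (x t : ℝ) :
    pdt (colDetFn (blocks φ ψ 1 N b)) x t =
      -(1 / 2) * colDetFn (update (blocks φ ψ 1 N b) 0 (φ 0)) x t -
        R.trace * colDetFn (blocks φ ψ 1 N b) x t := by
  refine (h.blockFlow 1 N b).pdt_forward hN hNK (fun x t => ?_) (fun j hj x t => ?_) x t
  · rw [blocks_fst φ ψ 1 (by omega) (by omega), h.fst_pred]
  · rw [blocks_fst φ ψ (j + 1 + 1) hj (by omega), blocks_fst φ ψ (j + 1) (by omega) (by omega),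
      h.fst_pred]

theorem pdx_eq_of_backward (h : FlowSystem L R φ ψ) {c : ℕ → ℝ → ℝ → Fin K → ℂ} {n : ℕ}
    (hc : BlockFlow L R n c) {b : ℕ} (hn : n < K)
    (hcψ : ∀ j, n ≤ j → j < K → c j = ψ (b + (j - n))) (x t : ℝ) :
    pdx (colDetFn c) x t =
      2 * colDetFn (update c (K - 1) (ψ (b + (K - n)))) x t + L.trace * colDetFn c x t := by
  refine hc.pdx_backward hn (fun x t => ?_) (fun j hj hj2 x t => ?_) x t
  · rw [hcψ _ (by omega) (by omega), h.snd_succ,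
      show b + (K - 1 - n) + 1 = b + (K - n) by omega]
  · rw [hcψ _ (by omega) (by omega), hcψ _ (by omega) (by omega), h.snd_succ,
      show b + (j + 1 - n) = b + (j - n) + 1 by omega]

/-- `D_t f · s + g h' / 2 = 0`. -/
theorem hirotaT_eq (h : FlowSystem L R φ ψ) (hK : N + M = K) (hN : 1 ≤ N) (hM : 1 ≤ M) (x t : ℝ) :
    pdt (colDetFn (blocks φ ψ 1 N 0)) x t * colDetFn (blocks φ ψ 1 N 1) x t -
      colDetFn (blocks φ ψ 1 N 0) x t * pdt (colDetFn (blocks φ ψ 1 N 1)) x t =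
    -(1 / 2) * (colDetFn (blocks φ ψ 0 (N + 1) 1) x t *
      colDetFn (blocks φ ψ 2 (N - 1) 0) x t) := by
  rw [h.pdt_eq_of_forward hN (by omega), h.pdt_eq_of_forward hN (by omega)]
  -- `ψ M` already is the last column of both determinants, so here the free column changes nothing.
  have e := colDet_blocks_plucker (fun k => φ k x t) (fun k => ψ k x t) hK hN hM (ψ M x t)
  rw [show update (blocks (fun k => φ k x t) (fun k => ψ k x t) 1 N 1) (K - 1) (ψ M x t) =
      blocks (fun k => φ k x t) (fun k => ψ k x t) 1 N 1 by
        rw [update_eq_self_iff, blocks_snd _ _ M (by omega) (by omega)],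
    show update (blocks (fun k => φ k x t) (fun k => ψ k x t) 2 (N - 1) 0) (K - 1) (ψ M x t) =
      blocks (fun k => φ k x t) (fun k => ψ k x t) 2 (N - 1) 0 by
        rw [update_eq_self_iff, blocks_snd _ _ M (by omega) (by omega)]] at e
  simp only [colDetFn, update_eval, blocks_eval]
  linear_combination (-1 / 2) * e

/-- The Plücker relation with last column `ψ (M + 1)`, the one created by `∂_x` at the end of the
`ψ` block. Together with the `x`-derivative of `hirotaT_eq` it yields the equation for `D_x D_t
f·s`. -/
theorem mul_pdx_eq (h : FlowSystem L R φ ψ) (hK : N + M = K) (hN : 1 ≤ N) (hM : 1 ≤ M) (x t : ℝ) :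
    colDetFn (blocks φ ψ 0 (N + 1) 1) x t * pdx (colDetFn (blocks φ ψ 2 (N - 1) 0)) x t =
    2 * (colDetFn (blocks φ ψ 1 N 0) x t * pdx (pdt (colDetFn (blocks φ ψ 1 N 1))) x t -
      pdt (colDetFn (blocks φ ψ 1 N 0)) x t * pdx (colDetFn (blocks φ ψ 1 N 1)) x t) := by
  have e0 := h.hirotaT_eq hK hN hM x t
  have hp : BlockFlow L R N (update (blocks φ ψ 1 N 1) 0 (φ 0)) :=
    (h.blockFlow 1 N 1).update 0 (by rw [if_pos (by omega)]; exact h.fst 0)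
  have hst : pdt (colDetFn (blocks φ ψ 1 N 1)) = fun x t =>
      -(1 / 2) * colDetFn (update (blocks φ ψ 1 N 1) 0 (φ 0)) x t +
        (-R.trace) * colDetFn (blocks φ ψ 1 N 1) x t := by
    funext x t
    rw [h.pdt_eq_of_forward hN (by omega)]
    ring
  have hsx := h.pdx_eq_of_backward (h.blockFlow 1 N 1) (b := 1) (by omega)
    (fun j hj _ => blocks_snd φ ψ _ hj rfl) x t
  have hpx := h.pdx_eq_of_backward hp (b := 1) (by omega)
    (fun j hj _ => by rw [update_of_ne (by omega)]; exact blocks_snd φ ψ _ hj rfl) x t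
  have hhx := h.pdx_eq_of_backward (h.blockFlow 2 (N - 1) 0) (b := 0) (by omega)
    (fun j hj _ => blocks_snd φ ψ _ hj rfl) x t
  rw [h.pdt_eq_of_forward hN (by omega), h.pdt_eq_of_forward hN (by omega)] at e0
  rw [hst, pdx_linear_comb hp.isSmooth (h.blockFlow 1 N 1).isSmooth,
    h.pdt_eq_of_forward hN (by omega), hsx, hpx, hhx]
  have e := colDet_blocks_plucker (fun k => φ k x t) (fun k => ψ k x t) hK hN hM (ψ (M + 1) x t)
  rw [update_comm (show K - 1 ≠ 0 by omega)] at e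
  rw [show 1 + (K - N) = M + 1 by omega, show 0 + (K - (N - 1)) = M + 1 by omega]
  simp only [colDetFn, update_eval, blocks_eval] at e0 ⊢
  linear_combination (-2) * e + 2 * L.trace * e0

/-- `D_x D_t g · f + g f = 0`. -/
theorem hirota_one_one_eq (h : FlowSystem L R φ ψ) (hL : L.det ≠ 0) (hK : N + M = K) (hN : 1 ≤ N)
    (hM : 1 ≤ M) (x t : ℝ) :
    hirota 1 1 (colDetFn (blocks φ ψ 0 (N + 1) 2)) (colDetFn (blocks φ ψ 1 N 1)) x t +
      colDetFn (blocks φ ψ 0 (N + 1) 2) x t * colDetFn (blocks φ ψ 1 N 1) x t = 0 := by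
  -- The `ψ` indices are one higher than in the definitions of `g` and `f`: `ψ 1` plays the role of
  -- `ψ`, and `ψ 0` that of the antiderivative which enters `f_t`.
  have hg := h.blockFlow 0 (N + 1) 2
  have hf := h.blockFlow 1 N 1
  have hqf : BlockFlow L R N (update (blocks φ ψ 1 N 1) N (ψ 0)) :=
    hf.update N (by rw [if_neg (by omega)]; exact h.snd 0)
  have hft : pdt (colDetFn (blocks φ ψ 1 N 1)) = fun x t =>
      -(1 / 2) * colDetFn (update (blocks φ ψ 1 N 1) N (ψ 0)) x t +
        R.trace * colDetFn (blocks φ ψ 1 N 1) x t := by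
    funext x t
    refine hf.pdt_backward (by omega) (fun x t => ?_) (fun j hj hj2 x t => ?_) x t
    · rw [blocks_snd φ ψ 1 (by omega) (by omega), h.snd_pred]
    · rw [blocks_snd φ ψ (j - N + 1 + 1) (by omega) (by omega),
        blocks_snd φ ψ (j - N + 1) (by omega) (by omega), h.snd_pred]
  have hfx : pdx (colDetFn (blocks φ ψ 1 N 1)) x t =
      2 * colDetFn (update (blocks φ ψ 1 N 1) (N - 1) (φ (N + 1))) x t -
        L.trace * colDetFn (blocks φ ψ 1 N 1) x t := by
    refine hf.pdx_forward hN (by omega) (fun x t => ?_) (fun j hj x t => ?_) x t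
    · rw [blocks_fst φ ψ N (by omega) (by omega), h.fst_succ]
    · rw [blocks_fst φ ψ (j + 1) (by omega) (by omega),
        blocks_fst φ ψ (j + 1 + 1) (by omega) (by omega), h.fst_succ]
  have hqfx : pdx (colDetFn (update (blocks φ ψ 1 N 1) N (ψ 0))) x t =
      2 * colDetFn (update (update (blocks φ ψ 1 N 1) N (ψ 0)) (N - 1) (φ (N + 1))) x t -
        L.trace * colDetFn (update (blocks φ ψ 1 N 1) N (ψ 0)) x t := by
    refine hqf.pdx_forward hN (by omega) (fun x t => ?_) (fun j hj x t => ?_) x t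
    · rw [update_of_ne (by omega), blocks_fst φ ψ N (by omega) (by omega), h.fst_succ]
    · rw [update_of_ne (by omega), update_of_ne (by omega),
        blocks_fst φ ψ (j + 1) (by omega) (by omega),
        blocks_fst φ ψ (j + 1 + 1) (by omega) (by omega), h.fst_succ]
  have hgx : pdx (colDetFn (blocks φ ψ 0 (N + 1) 2)) x t =
      2 * colDetFn (update (blocks φ ψ 0 (N + 1) 2) N (φ (N + 1))) x t -
        L.trace * colDetFn (blocks φ ψ 0 (N + 1) 2) x t := by
    refine hg.pdx_forward (by omega) (by omega) (fun x t => ?_) (fun j hj x t => ?_) x t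
    · rw [blocks_fst φ ψ N (by omega) (by omega), h.fst_succ]
    · rw [blocks_fst φ ψ j (by omega) (by omega),
        blocks_fst φ ψ (j + 1) (by omega) (by omega), h.fst_succ]
  rw [hirota_one_one hg.isSmooth hf.isSmooth, hft,
    pdx_linear_comb hqf.isSmooth hf.isSmooth, hqfx, hfx, hgx]
  -- For `M = 1`, `g` has no `ψ` column, and `g_t` is just a trace multiple of `g`.
  rcases Nat.lt_or_ge 1 M with hM1 | hM1
  · have hqg : BlockFlow L R (N + 1) (update (blocks φ ψ 0 (N + 1) 2) (N + 1) (ψ 1)) :=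
      hg.update (N + 1) (by rw [if_neg (by omega)]; exact h.snd 1)
    have hgt : pdt (colDetFn (blocks φ ψ 0 (N + 1) 2)) = fun x t =>
        -(1 / 2) * colDetFn (update (blocks φ ψ 0 (N + 1) 2) (N + 1) (ψ 1)) x t +
          R.trace * colDetFn (blocks φ ψ 0 (N + 1) 2) x t := by
      funext x t
      refine hg.pdt_backward (by omega) (fun x t => ?_) (fun j hj hj2 x t => ?_) x t
      · rw [blocks_snd φ ψ 2 (by omega) (by omega), h.snd_pred]
      · rw [blocks_snd φ ψ (j - N + 1 + 1) (by omega) (by omega),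
          blocks_snd φ ψ (j - N + 1) (by omega) (by omega), h.snd_pred]
    have hqgx : pdx (colDetFn (update (blocks φ ψ 0 (N + 1) 2) (N + 1) (ψ 1))) x t =
        2 * colDetFn (update (update (blocks φ ψ 0 (N + 1) 2) (N + 1) (ψ 1)) N (φ (N + 1))) x t -
          L.trace * colDetFn (update (blocks φ ψ 0 (N + 1) 2) (N + 1) (ψ 1)) x t := by
      refine hqg.pdx_forward (by omega) (by omega) (fun x t => ?_) (fun j hj x t => ?_) x t
      · rw [update_of_ne (by omega), blocks_fst φ ψ N (by omega) (by omega), h.fst_succ]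
      · rw [update_of_ne (by omega), update_of_ne (by omega),
          blocks_fst φ ψ j (by omega) (by omega),
          blocks_fst φ ψ (j + 1) (by omega) (by omega), h.fst_succ]
    rw [hgt, pdx_linear_comb hqg.isSmooth hg.isSmooth, hqgx, hgx]
    have e := colDet_blocks_two (fun k => φ k x t) (fun k => ψ k x t) hL
      (fun k => h.fst_succ k x t) (fun k => h.snd_succ k x t) hN (by omega)
    simp only [colDetFn, update_eval, blocks_eval]
    linear_combination -e
  · have hgt : pdt (colDetFn (blocks φ ψ 0 (N + 1) 2)) = fun x t =>
        0 * colDetFn (blocks φ ψ 0 (N + 1) 2) x t +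
          R.trace * colDetFn (blocks φ ψ 0 (N + 1) 2) x t := by
      funext x t
      rw [zero_mul, zero_add]
      obtain rfl : K = N + 1 := by omega
      exact hg.pdt_of_forward x t
    rw [hgt, pdx_linear_comb hg.isSmooth hg.isSmooth, hgx]
    have e := colDet_blocks_one (fun k => φ k x t) (fun k => ψ k x t) hL
      (fun k => h.fst_succ k x t) (fun k => h.snd_succ k x t) hN (by omega)
    simp only [colDetFn, update_eval, blocks_eval]
    linear_combination -e

/-- `D_x D_t h' · s + h' s = 0`. -/
theorem hirota_one_one_eq' (h : FlowSystem L R φ ψ) (hL : L.det ≠ 0) (hK : N + M = K)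
    (hN : 1 ≤ N) (hM : 1 ≤ M) (x t : ℝ) :
    hirota 1 1 (colDetFn (blocks φ ψ 2 (N - 1) 0)) (colDetFn (blocks φ ψ 1 N 1)) x t +
      colDetFn (blocks φ ψ 2 (N - 1) 0) x t * colDetFn (blocks φ ψ 1 N 1) x t = 0 := by
  -- With the `ψ` block in front, `s` and `h'` become the `f` and `g` of the swapped system, up to
  -- constants. For `N = 1` the `φ` block of `h'` is empty and nothing moves.
  obtain ⟨ε, hε⟩ := exists_colDet_rotate K M (by omega)
  obtain ⟨δ, hδ⟩ : ∃ δ : ℂ, ∀ c d : ℕ → Fin K → ℂ,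
      (∀ k < N - 1, d k = c (k + (M + 1))) → (∀ k < M + 1, d (k + (N - 1)) = c k) →
      colDet d = δ * colDet c := by
    rcases Nat.lt_or_ge 1 N with hN1 | hN1
    · obtain ⟨δ, hδ⟩ := exists_colDet_rotate K (M + 1) (by omega)
      refine ⟨δ, fun c d h1 h2 => hδ c d (fun k hk => h1 k (by omega)) fun k hk => ?_⟩
      rw [← h2 k hk]
      congr 1
      omega
    · refine ⟨1, fun c d _ h2 => ?_⟩
      rw [one_mul]
      refine colDet_congr fun j hj => ?_
      rw [← h2 j (by omega)]
      congr 1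
      omega
  have hs : colDetFn (blocks φ ψ 1 N 1) = fun x t => ε * colDetFn (blocks ψ φ 1 M 1) x t := by
    funext x t
    refine hε _ _ (fun k hk => ?_) fun k hk => ?_
    · rw [blocks_fst φ ψ (1 + k) (by omega) rfl, blocks_snd ψ φ (1 + k) (by omega) (by omega)]
    · rw [blocks_snd φ ψ (1 + k) (by omega) (by omega), blocks_fst ψ φ (1 + k) (by omega) rfl]
  have hh : colDetFn (blocks φ ψ 2 (N - 1) 0) =
      fun x t => δ * colDetFn (blocks ψ φ 0 (M + 1) 2) x t := by
    funext x t
    refine hδ _ _ (fun k hk => ?_) fun k hk => ?_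
    · rw [blocks_fst φ ψ (2 + k) (by omega) rfl, blocks_snd ψ φ (2 + k) (by omega) (by omega)]
    · rw [blocks_snd φ ψ k (by omega) (by omega), blocks_fst ψ φ k (by omega) (by omega)]
  have hd : (-L).det ≠ 0 := by
    rw [Matrix.det_neg]
    exact mul_ne_zero (pow_ne_zero _ (neg_ne_zero.2 one_ne_zero)) hL
  have e := h.swap.hirota_one_one_eq hd (show M + N = K by omega) hM hN x t
  rw [hs, hh, hirota_const_mul _ _ _ _ _ _ (h.swap.blockFlow _ _ _).isSmooth
    (h.swap.blockFlow _ _ _).isSmooth]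
  linear_combination δ * ε * e

end FlowSystem

end Flow

/-! ### Matrix exponentials as the solutions of the flows -/

section Exponential

variable {K : ℕ}

open scoped Matrix.Norms.Operator in
theorem hasDerivAt_exp_add_apply {P Q : Matrix (Fin K) (Fin K) ℂ} (h : Commute P Q) (y : ℝ)
    (i j : Fin K) :
    HasDerivAt (fun y : ℝ => NormedSpace.exp ((y : ℂ) • P + Q) i j)
      ((P * NormedSpace.exp ((y : ℂ) • P + Q)) i j) y := by
  have h1 : ∀ y : ℝ, NormedSpace.exp ((y : ℂ) • P + Q) =
      NormedSpace.exp ((y : ℂ) • P) * NormedSpace.exp Q := fun y =>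
    NormedSpace.exp_add_of_commute (h.smul_left _)
  have h2 : HasDerivAt (fun y : ℝ => NormedSpace.exp ((y : ℂ) • P) * NormedSpace.exp Q)
      (P * NormedSpace.exp ((y : ℂ) • P) * NormedSpace.exp Q) y := by
    have h3 : HasDerivAt (fun y : ℝ => NormedSpace.exp ((y : ℂ) • P))
        (P * NormedSpace.exp ((y : ℂ) • P)) y := by
      simp only [Complex.coe_smul]
      exact hasDerivAt_exp_smul_const' P y
    exact h3.mul_const _
  simp only [h1, ← mul_assoc]
  exact ((Matrix.entryLinearMap ℝ ℂ i j).toContinuousLinearMap.hasFDerivAt).comp_hasDerivAt y h2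

theorem hasDerivAt_exp_add_mulVec {P Q : Matrix (Fin K) (Fin K) ℂ} (h : Commute P Q)
    {v : ℝ → Fin K → ℂ} {v' : Fin K → ℂ} {y : ℝ} (hv : HasDerivAt v v' y) :
    HasDerivAt (fun y : ℝ => NormedSpace.exp ((y : ℂ) • P + Q) *ᵥ v y)
      (NormedSpace.exp ((y : ℂ) • P + Q) *ᵥ (P *ᵥ v y + v')) y := by
  have hc : Commute P (NormedSpace.exp ((y : ℂ) • P + Q)) :=
    Commute.exp_right (((Commute.refl P).smul_right (y : ℂ)).add_right h)
  rw [Matrix.mulVec_add, Matrix.mulVec_mulVec, ← hc.eq]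
  refine hasDerivAt_pi.2 fun i => ?_
  simp only [Matrix.mulVec, dotProduct, Pi.add_apply, ← Finset.sum_add_distrib]
  exact HasDerivAt.fun_sum fun j _ =>
    (hasDerivAt_exp_add_apply h y i j).mul (hasDerivAt_pi.1 hv j)

open scoped Matrix.Norms.Operator in
theorem isSmooth_exp_mulVec (L R : Matrix (Fin K) (Fin K) ℂ) (C : Fin K → ℂ) :
    IsSmooth fun x t : ℝ => NormedSpace.exp ((x : ℂ) • L + (t : ℂ) • R) *ᵥ C := by
  have h1 : ContDiff ℝ ∞ (NormedSpace.exp : Matrix (Fin K) (Fin K) ℂ → _) :=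
    contDiff_iff_contDiffAt.2 fun A => (NormedSpace.exp_analytic (𝕂 := ℝ) A).contDiffAt
  have h2 : ContDiff ℝ ∞ fun p : ℝ × ℝ => (p.1 : ℂ) • L + (p.2 : ℂ) • R := by
    simp only [Complex.coe_smul]
    exact (contDiff_fst.smul contDiff_const).add (contDiff_snd.smul contDiff_const)
  refine contDiff_pi.2 fun i => ?_
  simp only [Matrix.mulVec, dotProduct]
  refine ContDiff.sum fun j _ => ContDiff.mul ?_ contDiff_const
  exact (Matrix.entryLinearMap ℝ ℂ i j).toContinuousLinearMap.contDiff.comp (h1.comp h2)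

/-- If `v` flows, then `exp(-xL - tR) v` has zero derivative, in `x` everywhere and in `t` along `x
= 0`; so it equals `v(0, 0)`, and the exponential is inverted. -/
theorem columnFlow_one_iff {L R : Matrix (Fin K) (Fin K) ℂ} (h : Commute L R)
    (v : ℝ → ℝ → Fin K → ℂ) :
    ColumnFlow L R 1 v ↔
      ∃ C : Fin K → ℂ, ∀ x t : ℝ,
        v x t = NormedSpace.exp ((x : ℂ) • L + (t : ℂ) • R) *ᵥ C := by
  constructor
  · intro hv
    have hx : ∀ x t : ℝ, NormedSpace.exp ((x : ℂ) • -L + (t : ℂ) • -R) *ᵥ v x t =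
        NormedSpace.exp (((0 : ℝ) : ℂ) • -L + (t : ℂ) • -R) *ᵥ v 0 t := by
      intro x t
      have hd : ∀ y : ℝ, HasDerivAt (fun y : ℝ =>
          NormedSpace.exp ((y : ℂ) • -L + (t : ℂ) • -R) *ᵥ v y t) 0 y := fun y => by
        refine (hasDerivAt_exp_add_mulVec (h.neg_left.neg_right.smul_right _)
          (hv.smooth.hasDerivAt_pdx y t)).congr_deriv ?_
        rw [hv.pdx_eq, one_smul, Matrix.neg_mulVec, neg_add_cancel, Matrix.mulVec_zero]
      exact is_const_of_deriv_eq_zero (fun y => (hd y).differentiableAt)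
        (fun y => (hd y).deriv) x 0
    have ht : ∀ t : ℝ, NormedSpace.exp (((0 : ℝ) : ℂ) • -L + (t : ℂ) • -R) *ᵥ v 0 t = v 0 0 := by
      intro t
      have hd : ∀ y : ℝ, HasDerivAt (fun y : ℝ =>
          NormedSpace.exp ((y : ℂ) • -R + ((0 : ℝ) : ℂ) • -L) *ᵥ v 0 y) 0 y := fun y => by
        refine (hasDerivAt_exp_add_mulVec (h.symm.neg_left.neg_right.smul_right _)
          (hv.smooth.hasDerivAt_pdt 0 y)).congr_deriv ?_
        rw [hv.pdt_eq, one_smul, Matrix.neg_mulVec, neg_add_cancel, Matrix.mulVec_zero]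
      have := is_const_of_deriv_eq_zero (fun y => (hd y).differentiableAt)
        (fun y => (hd y).deriv) t 0
      rw [add_comm, this]
      simp
    refine ⟨v 0 0, fun x t => ?_⟩
    rw [← ht t, ← hx x t, Matrix.mulVec_mulVec, ← Matrix.exp_add_of_commute]
    · rw [smul_neg, smul_neg, ← neg_add, add_neg_cancel, NormedSpace.exp_zero, Matrix.one_mulVec]
    · rw [smul_neg, smul_neg, ← neg_add]
      exact (Commute.refl _).neg_right
  · rintro ⟨C, hC⟩
    obtain rfl : v = fun x t : ℝ => NormedSpace.exp ((x : ℂ) • L + (t : ℂ) • R) *ᵥ C := by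
      funext x t
      exact hC x t
    have hcL : ∀ x t : ℂ, Commute L (NormedSpace.exp (x • L + t • R)) := fun x t =>
      Commute.exp_right (((Commute.refl L).smul_right x).add_right (h.smul_right t))
    have hcR : ∀ x t : ℂ, Commute R (NormedSpace.exp (x • L + t • R)) := fun x t =>
      Commute.exp_right ((h.symm.smul_right x).add_right ((Commute.refl R).smul_right t))
    refine ⟨isSmooth_exp_mulVec L R C, fun x t => ?_, fun x t => ?_⟩
    · refine (hasDerivAt_exp_add_mulVec (h.smul_right _) (hasDerivAt_const x C)).deriv.trans ?_
      rw [add_zero, one_smul, Matrix.mulVec_mulVec, Matrix.mulVec_mulVec, (hcL _ _).eq]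
    · have := (hasDerivAt_exp_add_mulVec (h.symm.smul_right (x : ℂ)) (hasDerivAt_const t C)).deriv
      simp only [add_comm _ ((x : ℂ) • L)] at this
      refine this.trans ?_
      rw [add_zero, one_smul, Matrix.mulVec_mulVec, Matrix.mulVec_mulVec, (hcR _ _).eq]

theorem columnFlow_neg_one_iff {L R : Matrix (Fin K) (Fin K) ℂ} (h : Commute L R)
    (v : ℝ → ℝ → Fin K → ℂ) :
    ColumnFlow L R (-1) v ↔
      ∃ C : Fin K → ℂ, ∀ x t : ℝ,
        v x t = NormedSpace.exp (-((x : ℂ) • L) - (t : ℂ) • R) *ᵥ C := by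
  have h1 : ColumnFlow L R (-1) v ↔ ColumnFlow (-L) (-R) 1 v :=
    ⟨fun hv => by simpa using hv.neg, fun hv => by simpa using hv.neg⟩
  rw [h1, columnFlow_one_iff h.neg_left.neg_right]
  simp only [smul_neg, sub_eq_add_neg]

end Exponential

/-! ### From the conditions (1) to the theorem -/

section Wronskian

variable {K : ℕ} {L R : Matrix (Fin K) (Fin K) ℂ}

/-- An antiderivative leaves a function of `t` undetermined, but equality of mixed partials gives `ε
L v_t = -v/4`, and applying `R` fixes `v_t = ε R v`. Conversely `-4 v_t` is an antiderivative,
because `ε² = 1` and `RL = -1/4`. -/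
theorem columnFlow_iff (hRL : R * L = (-(1 / 4) : ℂ) • 1) {ε : ℂ} (hε : ε * ε = 1)
    (v : ℝ → ℝ → Fin K → ℂ) :
    ColumnFlow L R ε v ↔ IsSmooth v ∧ (∀ x t, pdx v x t = ε • (L *ᵥ v x t)) ∧
      ∃ V, IsXAntideriv V v ∧ ∀ x t, pdt v x t = (-(1 / 4) : ℂ) • V x t := by
  constructor
  · intro hv
    refine ⟨hv.smooth, hv.pdx_eq, fun x t => (-4 : ℂ) • pdt v x t, fun x t => ?_, fun x t => ?_⟩
    · have hd := ((hasDerivAt_mulVec R (hv.smooth.hasDerivAt_pdx x t)).const_smul ε).const_smul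
        (-4 : ℂ)
      simp only [hv.pdt_eq]
      refine hd.congr_deriv ?_
      rw [hv.pdx_eq, Matrix.mulVec_smul, smul_smul ε, hε, one_smul, Matrix.mulVec_mulVec, hRL,
        Matrix.smul_mulVec, Matrix.one_mulVec, smul_smul]
      norm_num
    · rw [smul_smul]
      norm_num
  · rintro ⟨hs, hx, V, hV, ht⟩
    refine ⟨hs, hx, fun x t => ?_⟩
    have e1 : pdx (pdt v) x t = (-(1 / 4) : ℂ) • v x t := by
      rw [show pdt v = fun x t => (-(1 / 4) : ℂ) • V x t from funext fun x => funext fun t => ht x t]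
      exact ((hV x t).const_smul (-(1 / 4) : ℂ)).deriv
    have e2 : pdt (pdx v) x t = ε • (L *ᵥ pdt v x t) := by
      rw [show pdx v = fun x t => ε • (L *ᵥ v x t) from funext fun x => funext fun t => hx x t]
      exact ((hasDerivAt_mulVec L (hs.hasDerivAt_pdt x t)).const_smul ε).deriv
    have e3 : R *ᵥ ((-(1 / 4) : ℂ) • v x t) = R *ᵥ (ε • (L *ᵥ pdt v x t)) := by
      rw [← e1, ← e2, hs.pdx_pdt]
    rw [Matrix.mulVec_smul, Matrix.mulVec_smul, Matrix.mulVec_mulVec, hRL, Matrix.smul_mulVec,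
      Matrix.one_mulVec, smul_comm] at e3
    have e4 : R *ᵥ v x t = ε • pdt v x t :=
      smul_right_injective _ (show (-(1 / 4) : ℂ) ≠ 0 by norm_num) e3
    rw [e4, smul_smul, hε, one_smul]

theorem ColumnFlow.pdx_iterate {ε : ℂ} {v : ℝ → ℝ → Fin K → ℂ} (hv : ColumnFlow L R ε v) (k : ℕ) :
    pdx^[k] v = fun x t => (ε • L) ^ k *ᵥ v x t := by
  induction k with
  | zero => simp
  | succ k ih =>
    rw [Function.iterate_succ_apply', ih]
    funext x t
    refine (hasDerivAt_mulVec _ (hv.smooth.hasDerivAt_pdx x t)).deriv.trans ?_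
    rw [hv.pdx_eq, ← Matrix.smul_mulVec, Matrix.mulVec_mulVec, ← pow_succ]

theorem FlowSystem.of_columnFlow (hRL : R * L = (-(1 / 4) : ℂ) • 1) (hc : Commute L R)
    {φ ψ : ℝ → ℝ → Fin K → ℂ} (hφ : ColumnFlow L R 1 φ) (hψ : ColumnFlow L R (-1) ψ) :
    FlowSystem L R (fun k x t => L ^ k *ᵥ φ x t) (fun k x t => (-L) ^ k *ᵥ ψ x t) where
  fst k := hφ.mulVec ((Commute.refl L).pow_left k) (hc.pow_left k)
  snd k := hψ.mulVec ((Commute.refl L).neg_left.pow_left k) (hc.neg_left.pow_left k)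
  fst_succ k x t := by rw [Matrix.mulVec_mulVec, pow_succ']
  snd_succ k x t := by rw [Matrix.mulVec_mulVec, pow_succ', ← Matrix.neg_mulVec, neg_mul, neg_neg]
  fst_pred k x t := by
    rw [Matrix.mulVec_mulVec, pow_succ', ← mul_assoc, hRL, smul_mul_assoc, one_mul,
      Matrix.smul_mulVec]
  snd_pred k x t := by
    rw [Matrix.mulVec_mulVec, pow_succ', ← mul_assoc, mul_neg, hRL, ← neg_smul, neg_neg,
      smul_mul_assoc, one_mul, Matrix.smul_mulVec]

theorem doubleWronskian_eq (φ ψ : ℝ → ℝ → Fin K → ℂ) (a n b : ℕ) :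
    doubleWronskian φ ψ a n b =
      colDetFn (blocks (fun k => pdx^[k] φ) (fun k => pdx^[k] ψ) a n b) := by
  funext x t
  simp only [doubleWronskian, colDetFn, colDet, blocks]
  congr 1
  ext i j
  simp only [Matrix.of_apply]
  split_ifs <;> rfl

theorem isBilinearSolution_wronskian {N M : ℕ} (hN : 1 ≤ N) (hM : 1 ≤ M)
    {L R : Matrix (Fin (N + M)) (Fin (N + M)) ℂ} (hRL : R * L = (-(1 / 4) : ℂ) • 1)
    {φ ψ : ℝ → ℝ → Fin (N + M) → ℂ} (hφ : ColumnFlow L R 1 φ) (hψ : ColumnFlow L R (-1) ψ) :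
    IsBilinearSolution (wronF φ ψ) (wronG φ ψ) (wronH φ ψ) (wronS φ ψ) := by
  have hinv : ((-4 : ℂ) • R) * L = 1 := by
    rw [smul_mul_assoc, hRL, smul_smul]
    norm_num
  have hinv' : L * ((-4 : ℂ) • R) = 1 := mul_eq_one_comm.1 hinv
  have hc : Commute L R := by
    have h4 : R = (-(1 / 4) : ℂ) • ((-4 : ℂ) • R) := by
      rw [smul_smul]
      norm_num
    have : Commute L ((-4 : ℂ) • R) := hinv'.trans hinv.symm
    rw [h4]
    exact this.smul_right _
  have hdet : L.det ≠ 0 := (Matrix.isUnit_det_of_left_inverse hinv).ne_zero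
  have hφk : (fun k => pdx^[k] φ) = fun k x t => L ^ k *ᵥ φ x t := by
    funext k
    rw [hφ.pdx_iterate, one_smul]
  have hψk : (fun k => pdx^[k] ψ) = fun k x t => (-L) ^ k *ᵥ ψ x t := by
    funext k
    rw [hψ.pdx_iterate, neg_one_smul]
  have S : FlowSystem L R (fun k => pdx^[k] φ) (fun k => pdx^[k] ψ) := by
    rw [hφk, hψk]
    exact FlowSystem.of_columnFlow hRL hc hφ hψ
  -- `ψ'` extends the sequence of `x`-derivatives of `ψ` one step down: `4Rψ` is an
  -- `x`-antiderivative of `ψ`, as `-L · 4R = 1`.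
  let ψ' : ℕ → ℝ → ℝ → Fin (N + M) → ℂ := fun k x t => (-L) ^ k *ᵥ ((4 : ℂ) • R) *ᵥ ψ x t
  have S' : FlowSystem L R (fun k => pdx^[k] φ) ψ' := by
    rw [hφk]
    exact FlowSystem.of_columnFlow hRL hc hφ
      (hψ.mulVec (hc.symm.smul_left _) ((Commute.refl R).smul_left _))
  have hψ' : ∀ k, ψ' (k + 1) = pdx^[k] ψ := by
    intro k
    rw [congrFun hψk k]
    funext x t
    simp only [ψ', Matrix.mulVec_mulVec]
    congr 1
    rw [pow_succ, mul_assoc, show -L * (4 : ℂ) • R = L * ((-4 : ℂ) • R) by simp, hinv', mul_one]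
  have hshift : ∀ a n b, blocks (fun k => pdx^[k] φ) ψ' a n (b + 1) =
      blocks (fun k => pdx^[k] φ) (fun k => pdx^[k] ψ) a n b := by
    intro a n b
    funext j
    simp only [blocks, show b + 1 + (j - n) = b + (j - n) + 1 by omega, hψ']
  have hf := doubleWronskian_eq φ ψ 1 N 0
  have hg := doubleWronskian_eq φ ψ 0 (N + 1) 1
  have hh := doubleWronskian_eq φ ψ 2 (N - 1) 0
  have hs := doubleWronskian_eq φ ψ 1 N 1
  have sf := (S.blockFlow 1 N 0).isSmooth
  have sg := (S.blockFlow 0 (N + 1) 1).isSmooth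
  have sh := (S.blockFlow 2 (N - 1) 0).isSmooth
  have ss := (S.blockFlow 1 N 1).isSmooth
  have e1 := fun x t => S'.hirota_one_one_eq hdet rfl hN hM x t
  have e2 := fun x t => S.hirota_one_one_eq' hdet rfl hN hM x t
  have e4 := fun x t => S.hirotaT_eq rfl hN hM x t
  have e5 := fun x t => S.mul_pdx_eq rfl hN hM x t
  rw [hshift 1 N 0, hshift 0 (N + 1) 1] at e1
  rw [← hf, ← hg] at e1
  rw [← hh, ← hs] at e2
  rw [← hf, ← hg, ← hh, ← hs] at e4 e5
  rw [← hf] at sf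
  rw [← hg] at sg
  rw [← hh] at sh
  rw [← hs] at ss
  have sh' : IsSmooth (wronH φ ψ) := contDiff_const.mul sh
  -- The differentiated form of `e4`; subtracting `e5` turns its left side into `D_x D_t f·s` and
  -- its right side into a multiple of `D_x g·h'`.
  have e4x : ∀ x t,
      pdx (pdt (doubleWronskian φ ψ 1 N 0)) x t * doubleWronskian φ ψ 1 N 1 x t +
        pdt (doubleWronskian φ ψ 1 N 0) x t * pdx (doubleWronskian φ ψ 1 N 1) x t -
        (pdx (doubleWronskian φ ψ 1 N 0) x t * pdt (doubleWronskian φ ψ 1 N 1) x t +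
          doubleWronskian φ ψ 1 N 0 x t * pdx (pdt (doubleWronskian φ ψ 1 N 1)) x t) =
      -(1 / 2) * (pdx (doubleWronskian φ ψ 0 (N + 1) 1) x t * doubleWronskian φ ψ 2 (N - 1) 0 x t +
        doubleWronskian φ ψ 0 (N + 1) 1 x t * pdx (doubleWronskian φ ψ 2 (N - 1) 0) x t) := by
    intro x t
    have hd1 := ((sf.pdt.hasDerivAt_pdx x t).mul (ss.hasDerivAt_pdx x t)).sub
      ((sf.hasDerivAt_pdx x t).mul (ss.pdt.hasDerivAt_pdx x t))
    have hd2 := ((sg.hasDerivAt_pdx x t).mul (sh.hasDerivAt_pdx x t)).const_mul (-(1 / 2) : ℂ)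
    refine hd1.unique (hd2.congr_of_eventuallyEq ?_)
    exact Filter.Eventually.of_forall fun y => e4 y t
  have hhx : ∀ x t, pdx (wronH φ ψ) x t = -(I / 2) * pdx (doubleWronskian φ ψ 2 (N - 1) 0) x t :=
    fun x t => deriv_const_mul_field _
  refine ⟨⟨sf, sg, sh', ss⟩, e1, fun x t => ?_, fun x t => ?_, fun x t => ?_⟩
  · have := hirota_const_mul (-(I / 2)) 1 _ _ x t sh ss
    simp only [one_mul, mul_one] at this
    change hirota 1 1 (wronH φ ψ) (wronS φ ψ) x t = _ at this
    rw [this]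
    simp only [wronH, wronS]
    linear_combination (-(I / 2)) * e2 x t
  · rw [hirota_one_one (a := wronF φ ψ) (b := wronS φ ψ) sf ss, hirota_one_zero, hhx]
    simp only [wronH, wronF, wronG, wronS]
    linear_combination e4x x t - e5 x t - (1 / 2) *
      (pdx (doubleWronskian φ ψ 0 (N + 1) 1) x t * doubleWronskian φ ψ 2 (N - 1) 0 x t -
        doubleWronskian φ ψ 0 (N + 1) 1 x t * pdx (doubleWronskian φ ψ 2 (N - 1) 0) x t) * I_sq
  · rw [hirota_zero_one]
    simp only [wronH, wronF, wronG, wronS]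
    linear_combination e4 x t - (1 / 2) *
      (doubleWronskian φ ψ 0 (N + 1) 1 x t * doubleWronskian φ ψ 2 (N - 1) 0 x t) * I_sq

theorem wronskianCondition_iff (A : Matrix (Fin K) (Fin K) ℂ)
    (hRL : ((I / 2) • A⁻¹ ^ 2) * ((I / 2) • A ^ 2) = (-(1 / 4) : ℂ) • 1)
    (φ ψ : ℝ → ℝ → Fin K → ℂ) :
    WronskianCondition A φ ψ ↔ ColumnFlow ((I / 2) • A ^ 2) ((I / 2) • A⁻¹ ^ 2) 1 φ ∧
      ColumnFlow ((I / 2) • A ^ 2) ((I / 2) • A⁻¹ ^ 2) (-1) ψ := by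
  rw [columnFlow_iff hRL (by norm_num), columnFlow_iff hRL (by norm_num)]
  simp only [WronskianCondition, one_smul, neg_smul, Matrix.smul_mulVec]
  tauto

end Wronskian

theorem theorem1 (N M : ℕ) (hN : 1 ≤ N) (hM : 1 ≤ M)
    (A : Matrix (Fin (N + M)) (Fin (N + M)) ℂ) (hA : IsUnit A) :
    (∀ φ ψ : ℝ → ℝ → Fin (N + M) → ℂ, WronskianCondition A φ ψ →
      IsBilinearSolution (wronF φ ψ) (wronG φ ψ) (wronH φ ψ) (wronS φ ψ) ∧
      IsPKNSolutionOn
        (fun x t => wronG φ ψ x t / wronF φ ψ x t)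
        (fun x t => wronH φ ψ x t / wronS φ ψ x t)
        {p : ℝ × ℝ | wronF φ ψ p.1 p.2 ≠ 0 ∧ wronS φ ψ p.1 p.2 ≠ 0}) ∧
    (∀ φ ψ : ℝ → ℝ → Fin (N + M) → ℂ, WronskianCondition A φ ψ ↔
      ∃ C B : Fin (N + M) → ℂ,
        (∀ x t : ℝ, φ x t =
          NormedSpace.exp ((I / 2 * (x : ℂ)) • A ^ 2 + (I / 2 * (t : ℂ)) • A⁻¹ ^ 2) *ᵥ C) ∧
        (∀ x t : ℝ, ψ x t =
          NormedSpace.exp (-((I / 2 * (x : ℂ)) • A ^ 2) - (I / 2 * (t : ℂ)) • A⁻¹ ^ 2) *ᵥ B)) := by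
  have hdet : IsUnit A.det := (Matrix.isUnit_iff_isUnit_det A).1 hA
  have hc : Commute A A⁻¹ := (Matrix.mul_nonsing_inv A hdet).trans (Matrix.nonsing_inv_mul A hdet).symm
  have hRL : ((I / 2) • A⁻¹ ^ 2) * ((I / 2) • A ^ 2) = (-(1 / 4) : ℂ) • 1 := by
    rw [smul_mul_smul_comm, ← hc.symm.mul_pow, Matrix.nonsing_inv_mul A hdet, one_pow]
    congr 1
    linear_combination (1 / 4 : ℂ) * I_sq
  have hLR : Commute ((I / 2) • A ^ 2) ((I / 2) • A⁻¹ ^ 2) :=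
    ((hc.pow_pow 2 2).smul_left _).smul_right _
  refine ⟨fun φ ψ h => ?_, fun φ ψ => ?_⟩
  · obtain ⟨hφ, hψ⟩ := (wronskianCondition_iff A hRL φ ψ).1 h
    have hb := isBilinearSolution_wronskian hN hM hRL hφ hψ
    exact ⟨hb, hb.isPKNSolutionOn⟩
  · rw [wronskianCondition_iff A hRL, columnFlow_one_iff hLR, columnFlow_neg_one_iff hLR]
    simp only [smul_smul, mul_comm _ (I / 2), exists_and_left, exists_and_right]
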